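/- Let $\mathbf T=\mathbf R/2\pi\mathbf Z$, and for $f=\sum_{k\in\mathbf Z}\hat f(k)e^{ikx}$ put $\|f\|_{H^s}^2=\sum_{k\in\mathbf Z}(1+k^2)^s|\hat f(k)|^2$, $\|f\|_{\dot H^{\sigma}}^2=\sum_{k\ne0}|k|^{2\sigma}|\hat f(k)|^2$ and $\widehat{(-\Delta)^\gamma f}(k)=|k|^{2\gamma}\hat f(k)$. Fix $\nu>0$, $\gamma>\frac12$ and $s>\frac12$. Then there is a function $T:[0,\infty)\to(0,\infty)$ (depending on $\nu,\gamma,s$ only) such that the following holds for every $\alpha\in\mathbf R$ and every complex-valued $u_0\in H^s(\mathbf T)$ of the form $$u_0(x)=\sum_{k=1}^\infty a_{0k}e^{ikx}.$$ With $T=T(\|u_0\|_{H^s})$, the problem $$u_t-6uu_x+\nu(-\Delta)^\gamma u+\alpha u_{xxx}=0\quad(0<t<T),\qquad u(\cdot,0)=u_0,$$ has a unique solution $u\in C([0,T);H^s(\mathbf T))\cap L^2([0,T);\dot H^{s+\gamma}(\mathbf T))$, and this solution is of the form $$u(x,t)=\sum_{k=1}^\infty a_k(t)e^{ikx},\qquad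 0\le t<T.$$ Here the equation is understood, with $6uu_x=3(u^2)_x$, in the sense of distributions on $\mathbf T$: for every $\varphi\in C^\infty(\mathbf T)$ and every $0<t<T$ the function $t\mapsto\int_{\mathbf T}u\varphi\,dx$ is differentiable, with $$\frac{d}{dt}\int_{\mathbf T}u\,\varphi\,dx=-3\int_{\mathbf T}u^2\varphi'\,dx-\nu\int_{\mathbf T}u\,(-\Delta)^\gamma\varphi\,dx+\alpha\int_{\mathbf T}u\,\varphi'''\,dx .$$ -/

import Mathlib

open MeasureTheory Set Filter Topology
open scoped Real ContDiff ENNReal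

namespace KdVBurgers

/-- `0 < 2π`, needed for Haar measure on the circle `ℝ / 2πℤ`. -/
instance factTwoPiPos : Fact ((0 : ℝ) < 2 * π) := ⟨Real.two_pi_pos⟩

/-- The torus `𝐓 = ℝ / 2πℤ`. -/
abbrev Torus : Type := AddCircle (2 * π)

/-- Complex-valued `L²(𝐓)`. As a measure on `𝐓` we take the normalized Haar measure, so that
`‖f‖² = ∑ₖ |f̂(k)|²`, where `f̂(k)` is Mathlib's `fourierCoeff f k`, the coefficient of `e^{ikx}`. -/
abbrev L2Torus : Type := Lp ℂ 2 (@AddCircle.haarAddCircle (2 * π) factTwoPiPos)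

/-- `f ∈ H^s(𝐓)` (for `s ≥ 0`, so that `H^s ⊆ L²`): `∑ₖ (1 + k²)^s |f̂(k)|² < ∞`. -/
def MemH (s : ℝ) (f : L2Torus) : Prop :=
  Summable fun k : ℤ => (1 + (k : ℝ) ^ 2) ^ s * ‖fourierCoeff f k‖ ^ 2

/-- The norm of `f ∈ H^s(𝐓)`: `‖f‖² = ∑ₖ (1 + k²)^s |f̂(k)|²`. -/
noncomputable def normH (s : ℝ) (f : L2Torus) : ℝ :=
  Real.sqrt (∑' k : ℤ, (1 + (k : ℝ) ^ 2) ^ s * ‖fourierCoeff f k‖ ^ 2)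

/-- The square of the homogeneous norm, `∑_{k ≠ 0} |k|^{2σ} |f̂(k)|² ∈ [0, ∞]`. -/
noncomputable def homNormSq (σ : ℝ) (f : L2Torus) : ℝ≥0∞ :=
  ∑' k : {k : ℤ // k ≠ 0},
    ENNReal.ofReal (|((k : ℤ) : ℝ)| ^ (2 * σ) * ‖fourierCoeff f (k : ℤ)‖ ^ 2)

/-- `f = ∑_{k ≥ 1} aₖ e^{ikx}`: only the positive Fourier modes are present. -/
def PositiveModes (f : L2Torus) : Prop :=
  ∀ k : ℤ, k ≤ 0 → fourierCoeff f k = 0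

/-- `u ∈ C(J; H^s)`. -/
def ContinuousIntoH (s : ℝ) (J : Set ℝ) (u : ℝ → L2Torus) : Prop :=
  (∀ t ∈ J, MemH s (u t)) ∧
    ∀ t₀ ∈ J, Tendsto (fun t => normH s (u t - u t₀)) (𝓝[J] t₀) (𝓝 0)

/-- `u ∈ L²(J; Ḣ^σ)`. Since the space is separable, measurability amounts to measurability of each
Fourier coefficient. -/
def SqIntegrableIntoHomH (σ : ℝ) (J : Set ℝ) (u : ℝ → L2Torus) : Prop :=
  (∀ k : ℤ, AEStronglyMeasurable (fun t => fourierCoeff (u t) k) (volume.restrict J)) ∧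
    ∫⁻ t in J, homNormSq σ (u t) < ⊤

/-- The test functions `C^∞(𝐓)`, as smooth `2π`-periodic functions on the line. -/
def IsTestFunction (φ : ℝ → ℂ) : Prop :=
  ContDiff ℝ ∞ φ ∧ Function.Periodic φ (2 * π)

/-- The `k`-th Fourier coefficient of a `2π`-periodic function on the line. -/
noncomputable def periodicCoeff (φ : ℝ → ℂ) (k : ℤ) : ℂ :=
  (1 / (2 * π) : ℂ) * ∫ x in (0 : ℝ)..(2 * π), φ x * Complex.exp (-(Complex.I * k * x))

/-- `(-Δ)^γ φ` for a smooth periodic `φ`, through the Fourier multiplier `|k|^{2γ}`. -/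
noncomputable def fracLaplacian (γ : ℝ) (φ : ℝ → ℂ) (x : ℝ) : ℂ :=
  ∑' k : ℤ, ((|(k : ℝ)| ^ (2 * γ) : ℝ) : ℂ) * periodicCoeff φ k * Complex.exp (Complex.I * k * x)

/-- The bilinear pairing `∫₀^{2π} g φ dx` of a function on the torus with a periodic function. -/
noncomputable def pairing (g : Torus → ℂ) (φ : ℝ → ℂ) : ℂ :=
  ∫ x in (0 : ℝ)..(2 * π), g (x : Torus) * φ x

/-- `u_t - 6 u u_x + ν (-Δ)^γ u + α u_xxx = 0` for `0 < t < T`, in the sense of distributions on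
`𝐓`: the equation is tested against every `φ ∈ C^∞(𝐓)` and all space derivatives are moved to `φ`,
with `6 u u_x = 3 (u²)_x`. -/
def SolvesEquation (ν γ α T : ℝ) (u : ℝ → L2Torus) : Prop :=
  ∀ φ : ℝ → ℂ, IsTestFunction φ → ∀ t ∈ Ioo 0 T,
    HasDerivAt (fun τ => pairing (u τ) φ)
      (-3 * pairing (fun x => u t x ^ 2) (deriv φ)
        - ν * pairing (u t) (fracLaplacian γ φ)
        + α * pairing (u t) (iteratedDeriv 3 φ)) t

/-- `u ∈ C([0,T); H^s) ∩ L²([0,T); Ḣ^{s+γ})` is a solution of the initial value problem with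
data `u₀` on `[0,T)`. -/
structure IsSolution (ν γ α s T : ℝ) (u₀ : L2Torus) (u : ℝ → L2Torus) : Prop where
  continuousInto : ContinuousIntoH s (Ico 0 T) u
  sqIntegrableInto : SqIntegrableIntoHomH (s + γ) (Ico 0 T) u
  initial : u 0 = u₀
  equation : SolvesEquation ν γ α T u

end KdVBurgers

namespace KdVBurgers

/-! ### Fourier series on the torus -/

/-! When only positive frequencies occur, the quadratic term couples the mode `k` to modes strictly
below `k`. The equation becomes the triangular system `aₖ' = -lₖ aₖ + 3ik ∑_{i+j=k} aᵢ aⱼ`, where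
`lₖ = ν|k|^{2γ} - iαk³`. Duhamel's formula solves it recursively and for all time (`modeCoeff`).
What is left is to show that the modes sum to an `H^s` function on a time interval controlled by the
norm of the data.

The tool is a time-independent majorant. Since `γ > 1/2`, dissipation beats the derivative: on a
short interval `[0, T]` the Duhamel operator multiplied by `3k` is at most `ε`, uniformly in `k`
(`exists_time`). By induction `|aₖ(t)| ≤ e^{-νkt/2} Mₖ`, where `Mₖ = |aₖ(0)| + ε ∑_{i+j=k} Mᵢ Mⱼ`
(`norm_modeCoeff_le`). The exponential survives the convolution because its exponent is additive in
the frequency. The algebra property of `H^s`, `s > 1/2`, bounds `M` in the weighted `ℓ²` once `ε`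
times the norm of the data is small (`sum_weight_mul_majorant_sq_le`). Dominated convergence then
gives continuity into `H^s`. The factor `e^{-νkt/2}` gives the gain of `γ` derivatives in `L²` in
time (`lintegral_modeCoeff_le`), and rapid decay of the coefficients of test functions gives the
distributional equation (`solvesEquation_of_modes`). Only `Re lₖ` enters the choice of `T`, so `T`
does not depend on `α`.

Uniqueness holds among all solutions of the class, whatever their frequencies. The `H^s` bound puts
the coefficients in `ℓ¹`, and Duhamel's formula in the norm `sup e^{-κt}|wₖ(t)|` contracts the
difference `w` of two solutions by a factor `1/2` (`IsSolution.unique`). -/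

lemma fourier_torus_apply (n : ℤ) (x : ℝ) :
    fourier n (x : Torus) = Complex.exp (Complex.I * n * x) := by
  rw [fourier_coe_apply]
  congr 1
  have : (π : ℂ) ≠ 0 := by exact_mod_cast Real.pi_ne_zero
  push_cast
  field_simp

lemma fourierCoeff_congr_ae {f g : Torus → ℂ}
    (h : f =ᵐ[AddCircle.haarAddCircle] g) (k : ℤ) : fourierCoeff f k = fourierCoeff g k := by
  unfold fourierCoeff
  refine integral_congr_ae ?_
  filter_upwards [h] with x hx
  rw [hx]

lemma fourierCoeff_sub (f g : L2Torus) (k : ℤ) :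
    fourierCoeff (f - g : L2Torus) k = fourierCoeff f k - fourierCoeff g k := by
  rw [← fourierBasis_repr, ← fourierBasis_repr, ← fourierBasis_repr, map_sub]
  rfl

lemma L2Torus_ext {f g : L2Torus} (h : ∀ k, fourierCoeff f k = fourierCoeff g k) : f = g := by
  apply fourierBasis.repr.injective
  ext k
  rw [fourierBasis_repr, fourierBasis_repr, h]

lemma exists_L2Torus_fourierCoeff {c : ℤ → ℂ} (hc : Summable fun k => ‖c k‖ ^ 2) :
    ∃ f : L2Torus, ∀ k, fourierCoeff f k = c k := by
  have hm : Memℓp c 2 := memℓp_gen (by simpa using hc)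
  refine ⟨fourierBasis.repr.symm ⟨c, hm⟩, fun k => ?_⟩
  rw [← fourierBasis_repr, LinearIsometryEquiv.apply_symm_apply]

lemma integrable_L2Torus (f : L2Torus) : Integrable f AddCircle.haarAddCircle :=
  (Lp.memLp f).integrable (by norm_num)

lemma integrable_sq_L2Torus (f : L2Torus) :
    Integrable (fun x => f x ^ 2) AddCircle.haarAddCircle := by
  have := (Lp.memLp f).integrable_mul (Lp.memLp f) (p := 2) (q := 2)
  simpa [sq, Pi.mul_def] using this

/-- The Fourier coefficients of a square are the convolution of the Fourier coefficients. -/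
lemma hasSum_fourierCoeff_sq (f : L2Torus) (k : ℤ) :
    HasSum (fun j : ℤ => fourierCoeff f j * fourierCoeff f (k - j))
      (fourierCoeff (fun x => f x ^ 2) k) := by
  -- Parseval's identity is applied to `f` and `g = conj f · e^{ikx}`, for which `⟨g, f⟩` is the
  -- integral of `f² e^{-ikx}`.
  have hmem : MemLp (fun x => starRingEnd ℂ (f x) * fourier k x) 2
      AddCircle.haarAddCircle := by
    have h1 : MemLp (fun x => starRingEnd ℂ (f x)) 2 AddCircle.haarAddCircle :=
      (Lp.memLp f).star
    refine MemLp.of_le h1 (h1.aestronglyMeasurable.mul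
      (map_continuous (fourier k)).aestronglyMeasurable) ?_
    filter_upwards with x
    rw [norm_mul, fourier_apply, Circle.norm_coe, mul_one]
  set g : L2Torus := hmem.toLp _ with hg
  have hgae : g =ᵐ[AddCircle.haarAddCircle] fun x => starRingEnd ℂ (f x) * fourier k x :=
    hmem.coeFn_toLp
  have key := fourierBasis.hasSum_inner_mul_inner g f
  have h2 : ∀ j : ℤ, inner ℂ (fourierBasis j) f = fourierCoeff f j := by
    intro j
    rw [← HilbertBasis.repr_apply_apply, fourierBasis_repr]
  have h3 : ∀ j : ℤ, inner ℂ g (fourierBasis j) = fourierCoeff f (k - j) := by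
    intro j
    rw [← inner_conj_symm, ← HilbertBasis.repr_apply_apply, fourierBasis_repr,
      fourierCoeff_congr_ae hgae]
    unfold fourierCoeff
    rw [← integral_conj]
    congr 1
    ext x
    simp only [smul_eq_mul, map_mul, Complex.conj_conj, ← fourier_neg, neg_neg]
    rw [show -(k - j) = j + -k by ring, fourier_add]
    ring
  have h4 : inner ℂ g f = fourierCoeff (fun x => f x ^ 2) k := by
    rw [L2.inner_def]
    unfold fourierCoeff
    refine integral_congr_ae ?_
    filter_upwards [hgae] with x hx
    rw [hx]
    simp only [RCLike.inner_apply, map_mul, Complex.conj_conj, ← fourier_neg, smul_eq_mul]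
    ring
  rw [h4] at key
  have e : (fun j : ℤ => fourierCoeff f j * fourierCoeff f (k - j)) =
      fun j => inner ℂ g (fourierBasis j) * inner ℂ (fourierBasis j) f := by
    ext j
    rw [h2, h3, mul_comm]
  rw [e]
  exact key

/-- The factor `2π` converts the normalized Haar measure into Lebesgue measure on a period. -/
lemma pairing_eq_integral (h : Torus → ℂ) (ψ : Torus → ℂ) :
    pairing h (fun x => ψ x) = 2 * π * ∫ x, h x * ψ x ∂AddCircle.haarAddCircle := by
  unfold pairing
  have := AddCircle.intervalIntegral_preimage (2 * π) 0 (fun x => h x * ψ x)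
  rw [zero_add] at this
  rw [this, AddCircle.volume_eq_smul_haarAddCircle, integral_smul_measure,
    ENNReal.toReal_ofReal Real.two_pi_pos.le, Complex.real_smul]
  push_cast
  rfl

lemma pairing_exp (h : Torus → ℂ) (k : ℤ) :
    pairing h (fun x => Complex.exp (-(Complex.I * k * x))) = 2 * π * fourierCoeff h k := by
  have : (fun x : ℝ => Complex.exp (-(Complex.I * k * x))) = fun x : ℝ => fourier (-k) (x : Torus) := by
    ext x
    rw [fourier_torus_apply]
    push_cast
    ring_nf
  rw [this, pairing_eq_integral]
  simp [fourierCoeff, mul_comm]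

/-- Pairing an integrable function with an absolutely convergent Fourier series. -/
lemma hasSum_pairing {h : Torus → ℂ} (hh : Integrable h AddCircle.haarAddCircle)
    {c : ℤ → ℂ} (hc : Summable fun k => ‖c k‖) {ψ : ℝ → ℂ}
    (hψ : ∀ x, ψ x = ∑' k : ℤ, c k * Complex.exp (Complex.I * k * x)) :
    HasSum (fun k : ℤ => 2 * π * (c k * fourierCoeff h (-k))) (pairing h ψ) := by
  have e1 : ψ = fun x : ℝ => (fun y : Torus => ∑' k : ℤ, c k * fourier k y) x := by
    ext x
    rw [hψ]
    simp only [fourier_torus_apply]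
  rw [e1, pairing_eq_integral h (fun y : Torus => ∑' k : ℤ, c k * fourier k y)]
  refine HasSum.mul_left _ ?_
  have hint : ∀ k : ℤ, Integrable (fun x => h x * (c k * fourier k x))
      AddCircle.haarAddCircle := by
    intro k
    have := (hh.bdd_mul (c := 1) (f := fun x => fourier k x)
      (map_continuous (fourier k)).aestronglyMeasurable (by filter_upwards with x; rw [fourier_apply, Circle.norm_coe])).const_mul (c k)
    refine this.congr ?_
    filter_upwards with x
    ring
  have key := hasSum_integral_of_summable_integral_norm hint (by
    have : ∀ k, ∫ x, ‖h x * (c k * fourier k x)‖ ∂AddCircle.haarAddCircle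
        = ‖c k‖ * ∫ x, ‖h x‖ ∂AddCircle.haarAddCircle := by
      intro k
      rw [← integral_const_mul]
      congr 1
      ext x
      rw [norm_mul, norm_mul, fourier_apply, Circle.norm_coe]
      ring
    simp only [this]
    exact hc.mul_right _)
  have e2 : ∀ x, h x * ∑' k : ℤ, c k * fourier k x = ∑' k : ℤ, h x * (c k * fourier k x) :=
    fun x => tsum_mul_left.symm
  simp only [e2]
  have e3 : ∀ k : ℤ, c k * fourierCoeff h (-k) =
      ∫ x, h x * (c k * fourier k x) ∂AddCircle.haarAddCircle := by
    intro k
    unfold fourierCoeff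
    rw [← integral_const_mul]
    congr 1
    ext x
    simp only [neg_neg, smul_eq_mul]
    ring
  simp only [e3]
  exact key

/-! ### Test functions -/

lemma IsTestFunction.deriv {φ : ℝ → ℂ} (h : IsTestFunction φ) : IsTestFunction (deriv φ) := by
  refine ⟨?_, ?_⟩
  · exact (contDiff_infty_iff_deriv.1 h.1).2
  · intro x
    have : (fun y => φ (y + 2 * π)) = φ := funext h.2
    rw [← deriv_comp_add_const, this]

lemma IsTestFunction.iteratedDeriv {φ : ℝ → ℂ} (h : IsTestFunction φ) (n : ℕ) :
    IsTestFunction (iteratedDeriv n φ) := by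
  induction n with
  | zero => simpa using h
  | succ n ih => rw [iteratedDeriv_succ]; exact ih.deriv

lemma isTestFunction_exp (k : ℤ) :
    IsTestFunction fun x : ℝ => Complex.exp (-(Complex.I * k * x)) := by
  refine ⟨?_, ?_⟩
  · have : ContDiff ℝ ∞ (fun x : ℝ => (x : ℂ)) := Complex.ofRealCLM.contDiff
    fun_prop
  · intro x
    have : (fun x : ℝ => Complex.exp (-(Complex.I * k * x))) = fun x : ℝ => fourier (-k) (x : Torus) := by
      ext x
      rw [fourier_torus_apply]
      push_cast
      ring_nf
    rw [this]
    simp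

lemma periodicCoeff_deriv {φ : ℝ → ℂ} (h : IsTestFunction φ) (k : ℤ) :
    periodicCoeff (deriv φ) k = Complex.I * k * periodicCoeff φ k := by
  unfold periodicCoeff
  set v : ℝ → ℂ := fun x => Complex.exp (-(Complex.I * k * x)) with hv
  have hv' : ∀ x, HasDerivAt v (-(Complex.I * k) * v x) x := by
    intro x
    have h1 : HasDerivAt (fun x : ℝ => (x : ℂ)) 1 x := Complex.ofRealCLM.hasDerivAt
    have := ((h1.const_mul (Complex.I * k)).neg).cexp
    refine this.congr_deriv ?_
    change v x * -(Complex.I * k * 1) = -(Complex.I * k) * v x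
    ring
  have hφ : ∀ x, HasDerivAt φ (deriv φ x) x := fun x =>
    ((h.1.differentiable (by simp)) x).hasDerivAt
  have cφ' : Continuous (deriv φ) := h.deriv.1.continuous
  have cv : Continuous v := by fun_prop
  have key := intervalIntegral.integral_mul_deriv_eq_deriv_mul (a := 0) (b := 2 * π)
    (u := v) (v := φ) (fun x _ => hv' x) (fun x _ => hφ x)
    ((continuous_const.mul cv).intervalIntegrable _ _) (cφ'.intervalIntegrable _ _)
  -- Periodicity makes the boundary terms of the integration by parts cancel.
  have hp : v (2 * π) * φ (2 * π) = v 0 * φ 0 := by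
    have h1 := (isTestFunction_exp k).2 0
    have h2 := h.2 0
    rw [zero_add] at h1 h2
    rw [h2]
    congr 1
  rw [hp, sub_self, zero_sub] at key
  have e1 : ∫ x in (0 : ℝ)..2 * π, deriv φ x * v x = ∫ x in (0 : ℝ)..2 * π, v x * deriv φ x := by
    simp only [mul_comm]
  have e2 : ∫ x in (0 : ℝ)..2 * π, -(Complex.I * k) * v x * φ x =
      -(Complex.I * k) * ∫ x in (0 : ℝ)..2 * π, φ x * v x := by
    rw [← intervalIntegral.integral_const_mul]
    congr 1; ext x; ring
  rw [e1, key, e2]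
  ring

lemma exists_norm_periodicCoeff_le (φ : ℝ → ℂ) :
    ∃ C, ∀ k, ‖periodicCoeff φ k‖ ≤ C := by
  refine ⟨‖(1 / (2 * π) : ℂ)‖ * ∫ x in (0 : ℝ)..2 * π, ‖φ x‖, fun k => ?_⟩
  unfold periodicCoeff
  rw [norm_mul]
  gcongr
  refine (intervalIntegral.norm_integral_le_integral_norm Real.two_pi_pos.le).trans (le_of_eq ?_)
  congr 1
  ext x
  have : -(Complex.I * k * x) = ((-(k * x) : ℝ) : ℂ) * Complex.I := by push_cast; ring
  rw [norm_mul, this, Complex.norm_exp_ofReal_mul_I, mul_one]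

lemma periodicCoeff_iteratedDeriv {φ : ℝ → ℂ} (h : IsTestFunction φ) (n : ℕ) (k : ℤ) :
    periodicCoeff (iteratedDeriv n φ) k = (Complex.I * k) ^ n * periodicCoeff φ k := by
  induction n with
  | zero => simp
  | succ n ih =>
    rw [iteratedDeriv_succ, periodicCoeff_deriv (h.iteratedDeriv n), ih]
    ring

/-- Fourier coefficients of test functions decay rapidly. -/
lemma summable_pow_mul_periodicCoeff {φ : ℝ → ℂ} (h : IsTestFunction φ) (n : ℕ) :
    Summable fun k : ℤ => |(k : ℝ)| ^ n * ‖periodicCoeff φ k‖ := by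
  -- Two derivatives beyond `n` leave a summable factor `1/k²`. The bound is needed only off `k =
  -- 0`, where `1/k²` takes the value `0`.
  obtain ⟨C, hC⟩ := exists_norm_periodicCoeff_le (iteratedDeriv (n + 2) φ)
  have hs : Summable fun k : ℤ => C * (1 / (k : ℝ) ^ 2) :=
    (Real.summable_one_div_int_pow.2 (by norm_num)).mul_left C
  refine Summable.of_norm_bounded_eventually hs ?_
  rw [Filter.eventually_cofinite]
  refine (Set.finite_singleton (0 : ℤ)).subset fun k hk => ?_
  by_contra hk0
  apply hk
  have hk0 : (k : ℝ) ≠ 0 := by exact_mod_cast hk0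
  have := hC k
  rw [periodicCoeff_iteratedDeriv h, norm_mul, norm_pow, norm_mul, Complex.norm_I, one_mul,
    Complex.norm_intCast, pow_add, sq_abs] at this
  have h2 : 0 < (k : ℝ) ^ 2 := by positivity
  rw [Real.norm_of_nonneg (by positivity), mul_one_div, le_div_iff₀ h2]
  linarith

lemma summable_periodicCoeff {φ : ℝ → ℂ} (h : IsTestFunction φ) :
    Summable fun k : ℤ => ‖periodicCoeff φ k‖ := by
  simpa using summable_pow_mul_periodicCoeff h 0

lemma IsTestFunction.eq_tsum {φ : ℝ → ℂ} (h : IsTestFunction φ) (x : ℝ) :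
    φ x = ∑' k : ℤ, periodicCoeff φ k * Complex.exp (Complex.I * k * x) := by
  let Φ : C(Torus, ℂ) := ⟨h.2.lift, continuous_coinduced_dom.2 h.1.continuous⟩
  have hΦ : ∀ y : ℝ, Φ (y : Torus) = φ y := fun y => rfl
  have hcoef : ∀ k, fourierCoeff Φ k = periodicCoeff φ k := by
    intro k
    rw [fourierCoeff_eq_intervalIntegral _ _ 0, zero_add]
    unfold periodicCoeff
    rw [Complex.real_smul]
    push_cast
    congr 2
    ext y
    rw [hΦ, fourier_torus_apply, smul_eq_mul, mul_comm]
    push_cast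
    ring_nf
  have hsum : Summable (fourierCoeff Φ) := by
    refine Summable.of_norm ?_
    simp only [hcoef]
    exact summable_periodicCoeff h
  have := ContinuousMap.hasSum_apply (hasSum_fourier_series_of_summable hsum) (x : Torus)
  rw [← hΦ, ← this.tsum_eq]
  congr 1
  ext k
  rw [ContinuousMap.smul_apply, hcoef, fourier_torus_apply, smul_eq_mul]

lemma periodicCoeff_exp (k m : ℤ) :
    periodicCoeff (fun x : ℝ => Complex.exp (-(Complex.I * k * x))) m =
      if m = -k then 1 else 0 := by
  have h1 := fourierCoeff_eq_intervalIntegral (fun x : Torus => fourier (-k) x) m 0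
  have h2 : fourierCoeff (fun x : Torus => fourier (-k) x) m = if m = -k then 1 else 0 := by
    have := orthonormal_iff_ite.1 (orthonormal_fourier (T := 2 * π)) m (-k)
    rw [L2.inner_def] at this
    rw [← this]
    unfold fourierCoeff
    refine integral_congr_ae ?_
    filter_upwards [coeFn_fourierLp (T := 2 * π) 2 m, coeFn_fourierLp (T := 2 * π) 2 (-k)] with x h3 h4
    rw [h3, h4]
    simp [mul_comm]
  rw [← h2, h1, zero_add]
  unfold periodicCoeff
  rw [Complex.real_smul]
  push_cast
  congr 2
  ext y
  simp only [fourier_torus_apply, smul_eq_mul]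
  rw [mul_comm]
  push_cast
  ring_nf

lemma fracLaplacian_exp (γ : ℝ) (k : ℤ) :
    fracLaplacian γ (fun x : ℝ => Complex.exp (-(Complex.I * k * x))) =
      fun x : ℝ => ((|(k : ℝ)| ^ (2 * γ) : ℝ) : ℂ) * Complex.exp (-(Complex.I * k * x)) := by
  ext x
  unfold fracLaplacian
  rw [tsum_eq_single (-k)]
  · simp [periodicCoeff_exp]
  · intro m hm
    simp [periodicCoeff_exp, hm]

/-! ### A Duhamel estimate for scalar linear equations -/

lemma norm_exp_mul_ofReal (l : ℂ) (t : ℝ) : ‖Complex.exp (l * t)‖ = Real.exp (l.re * t) := by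
  rw [Complex.norm_exp]
  simp

/-- With the integrating factor `e^{lt}` the linear term disappears, and the forcing is bounded by
`B e^{(Re l + ρ)t}`, whose primitive is explicit. The rate `ρ` serves both signs: negative for decay
of the modes, positive for the weight in the uniqueness proof. -/
lemma norm_le_of_hasDerivAt_linear {T : ℝ} {f g : ℝ → ℂ} {l : ℂ} {ρ B : ℝ}
    (hl : 0 < l.re + ρ) (hf : ContinuousOn f (Icc 0 T))
    (hd : ∀ t ∈ Ioo 0 T, HasDerivAt f (-l * f t + g t) t)
    (hg : ∀ t ∈ Ioo 0 T, ‖g t‖ ≤ B * Real.exp (ρ * t)) {t : ℝ} (ht : t ∈ Ico 0 T) :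
    ‖f t‖ ≤ Real.exp (-l.re * t) * ‖f 0‖ +
      B * Real.exp (ρ * t) * ((1 - Real.exp (-(l.re + ρ) * t)) / (l.re + ρ)) := by
  set x := l.re + ρ with hx
  set z : ℝ → ℂ := fun t => Complex.exp (l * t) * f t with hz
  have hexp : ∀ t : ℝ, HasDerivAt (fun t : ℝ => Complex.exp (l * t)) (Complex.exp (l * t) * l) t := by
    intro t
    have h1 : HasDerivAt (fun x : ℝ => (x : ℂ)) 1 t := Complex.ofRealCLM.hasDerivAt
    simpa using (h1.const_mul l).cexp
  have hzc : ContinuousOn z (Icc 0 T) := by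
    refine ContinuousOn.mul (Continuous.continuousOn ?_) hf
    fun_prop
  have hzd : ∀ t ∈ Ioo 0 T, HasDerivAt z (Complex.exp (l * t) * g t) t := by
    intro t ht
    refine ((hexp t).mul (hd t ht)).congr_deriv ?_
    ring
  let Bd : ℝ → ℝ := fun t => B * (Real.exp (x * t) / x)
  have hBd : ∀ t, HasDerivAt Bd (B * Real.exp (x * t)) t := by
    intro t
    have h1 : HasDerivAt (fun t => x * t) (x * 1) t := (hasDerivAt_id t).const_mul x
    refine ((h1.exp.div_const x).const_mul B).congr_deriv ?_
    field_simp
  have hz0 : z 0 = f 0 := by simp [hz]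
  have main : ‖z t‖ ≤ ‖z 0‖ + (Bd t - Bd 0) := by
    rcases eq_or_lt_of_le ht.1 with h0 | h0
    · rw [← h0]; simp
    -- The derivative exists only for positive times, so the mean value inequality is used on `[a,
    -- t]` and then `a → 0` by continuity.
    have step : ∀ a ∈ Ioo 0 t, ‖z t‖ ≤ ‖z a‖ + (Bd t - Bd a) := by
      intro a ha
      have hsub : ∀ y ∈ Ico a t, y ∈ Ioo 0 T := fun y hy =>
        ⟨ha.1.trans_le hy.1, hy.2.trans ht.2⟩
      refine image_norm_le_of_norm_deriv_right_le_deriv_boundary (a := a) (b := t) (f := z)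
        (f' := fun y => Complex.exp (l * y) * g y)
        (B := fun y => ‖z a‖ + (Bd y - Bd a)) (B' := fun y => B * Real.exp (x * y))
        (hzc.mono (Icc_subset_Icc ha.1.le ht.2.le))
        (fun y hy => (hzd y (hsub y hy)).hasDerivWithinAt) (by simp)
        (fun y => ((hBd y).sub_const _).const_add _) ?_ ⟨ha.2.le, le_rfl⟩
      intro y hy
      rw [norm_mul, norm_exp_mul_ofReal, hx, add_mul, Real.exp_add]
      calc Real.exp (l.re * y) * ‖g y‖ ≤ Real.exp (l.re * y) * (B * Real.exp (ρ * y)) := by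
            gcongr; exact hg y (hsub y hy)
        _ = _ := by ring
    have hlim : Tendsto (fun a => ‖z a‖ + (Bd t - Bd a)) (𝓝[>] 0) (𝓝 (‖z 0‖ + (Bd t - Bd 0))) := by
      have h1 : Tendsto z (𝓝[>] 0) (𝓝 (z 0)) := by
        have h2 : 0 < T := h0.trans ht.2
        have := hzc 0 ⟨le_rfl, h2.le⟩
        exact this.mono_left (nhdsWithin_le_of_mem
          (mem_of_superset (Ioo_mem_nhdsGT h2) Ioo_subset_Icc_self))
      have h2 : Tendsto Bd (𝓝[>] 0) (𝓝 (Bd 0)) := (hBd 0).continuousAt.tendsto.mono_left nhdsWithin_le_nhds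
      exact h1.norm.add (tendsto_const_nhds.sub h2)
    refine ge_of_tendsto hlim ?_
    filter_upwards [Ioo_mem_nhdsGT h0] with a ha using step a ha
  have hft : ‖f t‖ = Real.exp (-l.re * t) * ‖z t‖ := by
    rw [hz, norm_mul, norm_exp_mul_ofReal, ← mul_assoc, ← Real.exp_add]
    simp
  rw [hft, ← hz0]
  calc Real.exp (-l.re * t) * ‖z t‖ ≤ Real.exp (-l.re * t) * (‖z 0‖ + (Bd t - Bd 0)) := by gcongr
    _ = _ := by
      have e1 : Real.exp (ρ * t) = Real.exp (-l.re * t) * Real.exp (x * t) := by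
        rw [← Real.exp_add]; congr 1; rw [hx]; ring
      have e2 : Real.exp (x * t) * Real.exp (-x * t) = 1 := by
        rw [← Real.exp_add]; simp
      simp only [Bd, mul_zero, Real.exp_zero]
      rw [e1]
      linear_combination (Real.exp (-l.re * t) * B / x) * e2

/-- The quantity is `∫₀ᵗ e^{-xτ} dτ`. The bound `t` serves low frequencies, the bound `1/x` high
ones. -/
lemma one_sub_exp_div_le {x t : ℝ} (hx : 0 < x) (ht : 0 ≤ t) :
    (1 - Real.exp (-x * t)) / x ≤ t ∧ (1 - Real.exp (-x * t)) / x ≤ 1 / x ∧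
      0 ≤ (1 - Real.exp (-x * t)) / x := by
  refine ⟨?_, ?_, ?_⟩
  · rw [div_le_iff₀ hx]
    have := Real.add_one_le_exp (-x * t)
    linarith
  · gcongr
    have := Real.exp_pos (-x * t)
    linarith
  · refine div_nonneg ?_ hx.le
    have : Real.exp (-x * t) ≤ 1 := Real.exp_le_one_iff.2 (by nlinarith)
    linarith

/-- This is where `γ > 1/2` enters: one derivative is of lower order than `|k|^{2γ}`, so it is
absorbed up to a constant. -/
lemma exists_le_mul_rpow_add {γ : ℝ} (hγ : 1 / 2 < γ) {η : ℝ} (hη : 0 < η) :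
    ∃ K : ℝ, 0 < K ∧ ∀ k : ℝ, 0 ≤ k → k ≤ η * k ^ (2 * γ) + K := by
  have h := (tendsto_rpow_atTop (y := 2 * γ - 1) (by linarith)).eventually_ge_atTop (1 / η)
  obtain ⟨K, hK⟩ := eventually_atTop.1 h
  refine ⟨max K 1, by positivity, fun k hk => ?_⟩
  rcases le_total k (max K 1) with h1 | h1
  · have : 0 ≤ η * k ^ (2 * γ) := by positivity
    linarith
  · have hk0 : 0 < k := lt_of_lt_of_le (by positivity) h1
    have h2 := hK k ((le_max_left _ _).trans h1)
    have h3 : k ^ (2 * γ) = k ^ (2 * γ - 1) * k := by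
      rw [← Real.rpow_add_one hk0.ne']; ring_nf
    rw [div_le_iff₀ hη] at h2
    rw [h3]
    have : 0 < max K 1 := by positivity
    nlinarith

/-- A time of existence: on `[0, T]` the Duhamel operator composed with `3 ∂ₓ` is as small as
desired, uniformly in the frequency. -/
lemma exists_time {γ c ε : ℝ} (hγ : 1 / 2 < γ) (hc : 0 < c) (hε : 0 < ε) :
    ∃ T : ℝ, 0 < T ∧ ∀ k x t : ℝ, 1 ≤ k → c * k ^ (2 * γ) ≤ x → 0 ≤ t → t ≤ T →
      3 * k * ((1 - Real.exp (-x * t)) / x) ≤ ε := by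
  -- Writing `φ` for the Duhamel factor, `kφ` splits into `(εc/6) k^{2γ} φ ≤ ε/6`, from `φ ≤ 1/x`,
  -- and `Kφ ≤ KT = ε/6`, from `φ ≤ t`; tripling gives `ε`.
  obtain ⟨K, hK, hk⟩ := exists_le_mul_rpow_add hγ (η := ε * c / 6) (by positivity)
  refine ⟨ε / (6 * K), by positivity, fun k x t hk1 hx ht htT => ?_⟩
  have hkp : 0 < k ^ (2 * γ) := Real.rpow_pos_of_pos (by linarith) _
  have hx0 : 0 < x := lt_of_lt_of_le (by positivity) hx
  obtain ⟨h1, h2, h3⟩ := one_sub_exp_div_le hx0 ht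
  set φ := (1 - Real.exp (-x * t)) / x
  have h4 : x * φ ≤ 1 := by
    calc x * φ ≤ x * (1 / x) := by gcongr
      _ = 1 := by field_simp
  have h5 : c * k ^ (2 * γ) * φ ≤ 1 := (mul_le_mul_of_nonneg_right hx h3).trans h4
  have h6 : K * φ ≤ ε / 6 := by
    calc K * φ ≤ K * (ε / (6 * K)) := by gcongr; linarith
      _ = ε / 6 := by field_simp
  have h7 : k * φ ≤ (ε * c / 6 * k ^ (2 * γ) + K) * φ := by
    gcongr; exact hk k (by linarith)
  nlinarith

/-! ### Convolution of weighted square-summable sequences -/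

/-- The weight `(1 + k²)^s` at the frequency `k = n + 1`. -/
noncomputable def weight (s : ℝ) (n : ℕ) : ℝ := (1 + ((n : ℝ) + 1) ^ 2) ^ s

lemma weight_pos (s : ℝ) (n : ℕ) : 0 < weight s n := Real.rpow_pos_of_pos (by positivity) _

lemma one_le_weight {s : ℝ} (hs : 0 ≤ s) (n : ℕ) : 1 ≤ weight s n :=
  Real.one_le_rpow (by nlinarith [sq_nonneg ((n : ℝ) + 1)]) hs

lemma summable_inv_one_add_sq_rpow {s : ℝ} (hs : 1 / 2 < s) :
    Summable fun k : ℤ => ((1 + (k : ℝ) ^ 2) ^ s)⁻¹ := by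
  have h := Real.summable_abs_int_rpow (b := 2 * s) (by linarith)
  refine Summable.of_norm_bounded_eventually h ?_
  rw [Filter.eventually_cofinite]
  refine (Set.finite_singleton (0 : ℤ)).subset fun k hk => ?_
  by_contra hk0
  apply hk
  have hk0 : (k : ℝ) ≠ 0 := by exact_mod_cast hk0
  have : 0 < |(k : ℝ)| := abs_pos.2 hk0
  rw [Real.norm_of_nonneg (by positivity), Real.rpow_neg this.le, Real.rpow_mul this.le]
  gcongr
  rw [Real.rpow_two, sq_abs]
  linarith

lemma summable_inv_weight {s : ℝ} (hs : 1 / 2 < s) : Summable fun n => (weight s n)⁻¹ := by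
  have hinj : Function.Injective fun n : ℕ => ((n : ℤ) + 1) := fun a b h => by
    simpa using h
  have := (summable_inv_one_add_sq_rpow hs).comp_injective hinj
  refine this.congr fun n => ?_
  simp [weight]

/-- The index `i + j + 1` stands for the frequency `(i+1) + (j+1)`, at most twice the larger one,
and `1 + (2m)² ≤ 4(1 + m²)`. -/
lemma weight_add_le {s : ℝ} (hs : 0 ≤ s) (i j : ℕ) :
    weight s (i + j + 1) ≤ 4 ^ s * (weight s i + weight s j) := by
  wlog h : j ≤ i generalizing i j
  · have := this j i (by omega)
    rwa [add_comm j i, add_comm (weight s j)] at this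
  have h1 : weight s (i + j + 1) ≤ 4 ^ s * weight s i := by
    unfold weight
    rw [← Real.mul_rpow (by norm_num) (by positivity)]
    refine Real.rpow_le_rpow (by positivity) ?_ hs
    have : (j : ℝ) ≤ i := by exact_mod_cast h
    have : (0 : ℝ) ≤ j := by positivity
    push_cast
    nlinarith
  have h2 : (0 : ℝ) ≤ 4 ^ s * weight s j := mul_nonneg (by positivity) (weight_pos s j).le
  linarith

/-- The constant in the algebra property of `H^s`. -/
noncomputable def algConst (s : ℝ) : ℝ := 4 ^ s * (2 * ∑' n, (weight s n)⁻¹)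

lemma algConst_nonneg (s : ℝ) : 0 ≤ algConst s :=
  mul_nonneg (by positivity) (mul_nonneg (by norm_num) (tsum_nonneg fun n => (inv_pos.2 (weight_pos s n)).le))

/-- Cauchy–Schwarz with the weights `wᵢwⱼ` leaves the factor `w ∑ 1/(wᵢwⱼ)`. By `weight_add_le` it
is at most `4^s ∑ (1/wᵢ + 1/wⱼ)`, which is bounded because `s > 1/2`. -/
lemma weight_mul_sq_convolution_le {s : ℝ} (hs : 1 / 2 < s) (M : ℕ → ℝ) (n : ℕ) :
    weight s (n + 1) * (∑ p ∈ Finset.HasAntidiagonal.antidiagonal n, M p.1 * M p.2) ^ 2 ≤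
      algConst s * ∑ p ∈ Finset.HasAntidiagonal.antidiagonal n,
        (weight s p.1 * M p.1 ^ 2) * (weight s p.2 * M p.2 ^ 2) := by
  have hw := weight_pos s
  have hCS := Finset.sum_sq_le_sum_mul_sum_of_sq_le_mul (Finset.HasAntidiagonal.antidiagonal n)
    (r := fun p => M p.1 * M p.2)
    (f := fun p => (weight s p.1 * M p.1 ^ 2) * (weight s p.2 * M p.2 ^ 2))
    (g := fun p => (weight s p.1)⁻¹ * (weight s p.2)⁻¹)
    (fun p _ => by have := hw p.1; have := hw p.2; positivity)
    (fun p _ => by have := hw p.1; have := hw p.2; positivity)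
    (fun p _ => le_of_eq (by have := (hw p.1).ne'; have := (hw p.2).ne'; field_simp))
  have hsum : ∑ p ∈ Finset.HasAntidiagonal.antidiagonal n, (weight s p.1)⁻¹ ≤ ∑' n, (weight s n)⁻¹ := by
    rw [Finset.Nat.sum_antidiagonal_eq_sum_range_succ_mk]
    exact (summable_inv_weight hs).sum_le_tsum _ fun i _ => (inv_pos.2 (hw i)).le
  have hsum' : ∑ p ∈ Finset.HasAntidiagonal.antidiagonal n, (weight s p.2)⁻¹ ≤ ∑' n, (weight s n)⁻¹ := by
    rw [← Finset.Nat.sum_antidiagonal_swap]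
    exact hsum
  have hg : weight s (n + 1) * ∑ p ∈ Finset.HasAntidiagonal.antidiagonal n, (weight s p.1)⁻¹ * (weight s p.2)⁻¹ ≤
      algConst s := by
    calc weight s (n + 1) * ∑ p ∈ Finset.HasAntidiagonal.antidiagonal n, (weight s p.1)⁻¹ * (weight s p.2)⁻¹
        ≤ ∑ p ∈ Finset.HasAntidiagonal.antidiagonal n, 4 ^ s * ((weight s p.2)⁻¹ + (weight s p.1)⁻¹) := by
          rw [Finset.mul_sum]
          refine Finset.sum_le_sum fun p hp => ?_
          have h1 := hw p.1
          have h2 := hw p.2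
          have h3 := weight_add_le (s := s) (by linarith) p.1 p.2
          rw [Finset.HasAntidiagonal.mem_antidiagonal.1 hp] at h3
          calc weight s (n + 1) * ((weight s p.1)⁻¹ * (weight s p.2)⁻¹)
              ≤ 4 ^ s * (weight s p.1 + weight s p.2) * ((weight s p.1)⁻¹ * (weight s p.2)⁻¹) := by
                gcongr
            _ = _ := by field_simp
      _ ≤ algConst s := by
          rw [← Finset.mul_sum, Finset.sum_add_distrib, algConst]
          gcongr
          linarith
  calc weight s (n + 1) * (∑ p ∈ Finset.HasAntidiagonal.antidiagonal n, M p.1 * M p.2) ^ 2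
      ≤ weight s (n + 1) * ((∑ p ∈ Finset.HasAntidiagonal.antidiagonal n,
          (weight s p.1 * M p.1 ^ 2) * (weight s p.2 * M p.2 ^ 2)) *
          ∑ p ∈ Finset.HasAntidiagonal.antidiagonal n, (weight s p.1)⁻¹ * (weight s p.2)⁻¹) := by
        have := hw (n + 1)
        gcongr
    _ = (weight s (n + 1) * ∑ p ∈ Finset.HasAntidiagonal.antidiagonal n, (weight s p.1)⁻¹ * (weight s p.2)⁻¹) *
        ∑ p ∈ Finset.HasAntidiagonal.antidiagonal n, (weight s p.1 * M p.1 ^ 2) * (weight s p.2 * M p.2 ^ 2) := by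
        ring
    _ ≤ _ := by
        refine mul_le_mul_of_nonneg_right hg (Finset.sum_nonneg fun p _ => ?_)
        have := hw p.1; have := hw p.2; positivity

/-- The antidiagonals below `N` fill a triangle inside the square `[0, N)²`. -/
lemma sum_range_sum_antidiagonal_le {f : ℕ → ℝ} (hf : ∀ n, 0 ≤ f n) (N : ℕ) :
    ∑ n ∈ Finset.range N, ∑ p ∈ Finset.HasAntidiagonal.antidiagonal n, f p.1 * f p.2 ≤
      (∑ n ∈ Finset.range N, f n) ^ 2 := by
  rw [sq, Finset.sum_mul_sum, ← Finset.sum_product']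
  refine (Finset.sum_le_sum fun n hn => ?_).trans
    (Finset.sum_fiberwise_le_sum_of_sum_fiber_nonneg (t := Finset.range N)
      (g := fun p : ℕ × ℕ => p.1 + p.2) fun n _ => ?_)
  · refine Finset.sum_le_sum_of_subset_of_nonneg (fun p hp => ?_)
      fun p _ _ => mul_nonneg (hf _) (hf _)
    rw [Finset.HasAntidiagonal.mem_antidiagonal] at hp
    rw [Finset.mem_range] at hn
    simp only [Finset.mem_filter, Finset.mem_product, Finset.mem_range]
    omega
  · exact Finset.sum_nonneg fun p _ => mul_nonneg (hf _) (hf _)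

/-! ### A quadratic majorant -/

/-- The majorant `Mₖ = bₖ + ε ∑_{i+j=k} Mᵢ Mⱼ`, with the index shifted by one. -/
noncomputable def majorant (ε : ℝ) (b : ℕ → ℝ) : ℕ → ℝ
  | 0 => b 0
  | n + 1 => b (n + 1) + ε * ∑ p ∈ (Finset.HasAntidiagonal.antidiagonal n).attach,
      majorant ε b p.1.1 * majorant ε b p.1.2
decreasing_by
  all_goals
    have := Finset.HasAntidiagonal.mem_antidiagonal.1 p.2
    omega

lemma majorant_succ (ε : ℝ) (b : ℕ → ℝ) (n : ℕ) :
    majorant ε b (n + 1) = b (n + 1) + ε * ∑ p ∈ Finset.HasAntidiagonal.antidiagonal n,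
      majorant ε b p.1 * majorant ε b p.2 := by
  rw [majorant, Finset.sum_attach (Finset.HasAntidiagonal.antidiagonal n)
    (fun p => majorant ε b p.1 * majorant ε b p.2)]

lemma majorant_nonneg {ε : ℝ} (hε : 0 ≤ ε) {b : ℕ → ℝ} (hb : ∀ n, 0 ≤ b n) (n : ℕ) :
    0 ≤ majorant ε b n := by
  induction n using Nat.strong_induction_on with
  | _ n ih =>
    cases n with
    | zero => rw [majorant]; exact hb 0
    | succ n =>
      rw [majorant_succ]
      refine add_nonneg (hb _) (mul_nonneg hε (Finset.sum_nonneg fun p hp => ?_))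
      have := Finset.HasAntidiagonal.mem_antidiagonal.1 hp
      exact mul_nonneg (ih _ (by omega)) (ih _ (by omega))

/-- By triangularity the partial sum `E_{N+1}` is controlled by `E_N`: `E_{N+1} ≤ 2R² + 2ε²A E_N²`
with `A = algConst s`. The smallness condition says exactly that the bound `4R²` reproduces itself,
so no summability is needed beforehand. -/
lemma sum_weight_mul_majorant_sq_le {s : ℝ} (hs : 1 / 2 < s) {ε R : ℝ} {b : ℕ → ℝ}
    (hR : ∀ N, ∑ n ∈ Finset.range N, weight s n * b n ^ 2 ≤ R ^ 2)
    (hsmall : 16 * ε ^ 2 * algConst s * R ^ 2 ≤ 1) (N : ℕ) :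
    ∑ n ∈ Finset.range N, weight s n * majorant ε b n ^ 2 ≤ 4 * R ^ 2 := by
  have hw := weight_pos s
  induction N with
  | zero => simp; positivity
  | succ N ih =>
    set M := majorant ε b
    have hstep : ∀ n, weight s (n + 1) * M (n + 1) ^ 2 ≤ 2 * (weight s (n + 1) * b (n + 1) ^ 2) +
        2 * ε ^ 2 * algConst s * ∑ p ∈ Finset.HasAntidiagonal.antidiagonal n,
          (weight s p.1 * M p.1 ^ 2) * (weight s p.2 * M p.2 ^ 2) := by
      intro n
      have h1 := weight_mul_sq_convolution_le hs M n
      have h2 : M (n + 1) = _ := majorant_succ ε b n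
      rw [h2]
      change weight s (n + 1) * (b (n + 1) + ε * ∑ p ∈ Finset.HasAntidiagonal.antidiagonal n, M p.1 * M p.2) ^ 2 ≤ _
      set G := ∑ p ∈ Finset.HasAntidiagonal.antidiagonal n, M p.1 * M p.2
      have h3 : (b (n + 1) + ε * G) ^ 2 ≤ 2 * b (n + 1) ^ 2 + 2 * ε ^ 2 * G ^ 2 := by
        nlinarith [sq_nonneg (b (n + 1) - ε * G)]
      calc weight s (n + 1) * (b (n + 1) + ε * G) ^ 2
          ≤ weight s (n + 1) * (2 * b (n + 1) ^ 2 + 2 * ε ^ 2 * G ^ 2) := by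
            have := hw (n + 1); gcongr
        _ = 2 * (weight s (n + 1) * b (n + 1) ^ 2) + 2 * ε ^ 2 * (weight s (n + 1) * G ^ 2) := by ring
        _ ≤ _ := by
            have := mul_le_mul_of_nonneg_left h1 (show 0 ≤ 2 * ε ^ 2 by positivity)
            linarith
    have h0 : M 0 = b 0 := by simp only [M]; rw [majorant]
    have hnn : ∀ n, 0 ≤ weight s n * M n ^ 2 := fun n => by have := hw n; positivity
    have hdouble := sum_range_sum_antidiagonal_le hnn N
    set E := ∑ n ∈ Finset.range N, weight s n * M n ^ 2
    have hE : 0 ≤ E := Finset.sum_nonneg fun n _ => hnn n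
    have hE2 : E ^ 2 ≤ 16 * R ^ 4 := by nlinarith
    have hb0 : 0 ≤ weight s 0 * b 0 ^ 2 := by have := hw 0; positivity
    have hRN := hR (N + 1)
    rw [Finset.sum_range_succ'] at hRN ⊢
    have hA := algConst_nonneg s
    have key := Finset.sum_le_sum fun n (_ : n ∈ Finset.range N) => hstep n
    rw [Finset.sum_add_distrib, ← Finset.mul_sum, ← Finset.mul_sum] at key
    have h5 : 2 * ε ^ 2 * algConst s * ∑ n ∈ Finset.range N, ∑ p ∈ Finset.HasAntidiagonal.antidiagonal n,
          (weight s p.1 * M p.1 ^ 2) * (weight s p.2 * M p.2 ^ 2) ≤ 2 * R ^ 2 := by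
      calc _ ≤ 2 * ε ^ 2 * algConst s * (16 * R ^ 4) := by
            gcongr; exact hdouble.trans hE2
        _ = 16 * ε ^ 2 * algConst s * R ^ 2 * (2 * R ^ 2) := by ring
        _ ≤ 1 * (2 * R ^ 2) := by gcongr
        _ = 2 * R ^ 2 := one_mul _
    rw [h0]
    linarith

lemma summable_weight_mul_majorant_sq {s : ℝ} (hs : 1 / 2 < s) {ε R : ℝ} {b : ℕ → ℝ}
    (hR : ∀ N, ∑ n ∈ Finset.range N, weight s n * b n ^ 2 ≤ R ^ 2)
    (hsmall : 16 * ε ^ 2 * algConst s * R ^ 2 ≤ 1) :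
    Summable fun n => weight s n * majorant ε b n ^ 2 :=
  summable_of_sum_range_le (fun n => mul_nonneg (weight_pos s n).le (sq_nonneg _))
    (sum_weight_mul_majorant_sq_le hs hR hsmall)

/-! ### The triangular system for the Fourier modes -/

/-- The convolution of two sequences whose indices are shifted by one. -/
def shiftConv {R : Type*} [Semiring R] (c : ℕ → R) : ℕ → R
  | 0 => 0
  | n + 1 => ∑ p ∈ Finset.HasAntidiagonal.antidiagonal n, c p.1 * c p.2

lemma majorant_eq (ε : ℝ) (b : ℕ → ℝ) (n : ℕ) :
    majorant ε b n = b n + ε * shiftConv (majorant ε b) n := by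
  cases n with
  | zero => rw [majorant, shiftConv]; simp
  | succ n => rw [majorant_succ, shiftConv]

lemma shiftConv_nonneg {M : ℕ → ℝ} (hM : ∀ n, 0 ≤ M n) (n : ℕ) : 0 ≤ shiftConv M n := by
  cases n with
  | zero => exact le_rfl
  | succ n => exact Finset.sum_nonneg fun p _ => mul_nonneg (hM _) (hM _)

/-- The solution `c` of `cₙ' = -lₙ cₙ + 3 i (n + 1) (c * c)ₙ`, `cₙ(0) = aₙ`. -/
noncomputable def modeCoeff (l a : ℕ → ℂ) : ℕ → ℝ → ℂ
  | 0 => fun t => Complex.exp (-l 0 * t) * a 0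
  | n + 1 => fun t => Complex.exp (-l (n + 1) * t) * (a (n + 1) + ∫ τ in (0 : ℝ)..t,
      Complex.exp (l (n + 1) * τ) * (3 * Complex.I * ((n + 1 : ℕ) + 1) *
        ∑ p ∈ (Finset.HasAntidiagonal.antidiagonal n).attach,
          modeCoeff l a p.1.1 τ * modeCoeff l a p.1.2 τ))
decreasing_by
  all_goals
    have := Finset.HasAntidiagonal.mem_antidiagonal.1 p.2
    omega

lemma modeCoeff_eq (l a : ℕ → ℂ) (n : ℕ) :
    modeCoeff l a n = fun t : ℝ => Complex.exp (-l n * t) * (a n + ∫ τ in (0 : ℝ)..t,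
      Complex.exp (l n * τ) * (3 * Complex.I * (n + 1) *
        shiftConv (fun i => modeCoeff l a i τ) n)) := by
  cases n with
  | zero => rw [modeCoeff]; simp [shiftConv]
  | succ n =>
    rw [modeCoeff]
    ext t
    congr 3
    ext τ
    rw [shiftConv, Finset.sum_attach (Finset.HasAntidiagonal.antidiagonal n)
      (fun p => modeCoeff l a p.1 τ * modeCoeff l a p.2 τ)]

lemma modeCoeff_zero (l a : ℕ → ℂ) (n : ℕ) : modeCoeff l a n 0 = a n := by
  rw [modeCoeff_eq]; simp

/-- Triangularity: the convolution at `n` sees only indices below `n`, which lets the strong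
induction for `modeCoeff` run. -/
lemma continuous_shiftConv {c : ℕ → ℝ → ℂ} {n : ℕ} (h : ∀ i < n, Continuous (c i)) :
    Continuous fun t => shiftConv (fun i => c i t) n := by
  cases n with
  | zero => exact continuous_const
  | succ n =>
    refine continuous_finsetSum _ fun p hp => ?_
    have := Finset.HasAntidiagonal.mem_antidiagonal.1 hp
    exact (h _ (by omega)).mul (h _ (by omega))

lemma hasDerivAt_cexp_mul (l : ℂ) (t : ℝ) :
    HasDerivAt (fun t : ℝ => Complex.exp (l * t)) (Complex.exp (l * t) * l) t := by
  have h1 : HasDerivAt (fun x : ℝ => (x : ℂ)) 1 t := Complex.ofRealCLM.hasDerivAt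
  simpa using (h1.const_mul l).cexp

lemma continuous_modeCoeff (l a : ℕ → ℂ) (n : ℕ) : Continuous (modeCoeff l a n) := by
  induction n using Nat.strong_induction_on with
  | _ n ih =>
    rw [modeCoeff_eq]
    have h1 := continuous_shiftConv (c := modeCoeff l a) ih
    have h2 : Continuous fun τ : ℝ => Complex.exp (l n * τ) * (3 * Complex.I * (n + 1) *
        shiftConv (fun i => modeCoeff l a i τ) n) := by fun_prop
    refine Continuous.mul (by fun_prop) (continuous_const.add ?_)
    exact intervalIntegral.continuous_primitive (fun _ _ => h2.intervalIntegrable _ _) 0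

lemma hasDerivAt_modeCoeff (l a : ℕ → ℂ) (n : ℕ) (t : ℝ) :
    HasDerivAt (modeCoeff l a n) (-l n * modeCoeff l a n t +
      3 * Complex.I * (n + 1) * shiftConv (fun i => modeCoeff l a i t) n) t := by
  have h1 := continuous_shiftConv (c := modeCoeff l a) (n := n)
    fun i _ => continuous_modeCoeff l a i
  have h2 : Continuous fun τ : ℝ => Complex.exp (l n * τ) * (3 * Complex.I * (n + 1) *
      shiftConv (fun i => modeCoeff l a i τ) n) := by fun_prop
  have h3 := intervalIntegral.integral_hasDerivAt_right (h2.intervalIntegrable 0 t)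
    h2.stronglyMeasurable.stronglyMeasurableAtFilter h2.continuousAt
  have h4 := (hasDerivAt_cexp_mul (-l n) t).mul (h3.const_add (a n))
  have h5 : Complex.exp (-l n * t) * Complex.exp (l n * t) = 1 := by
    rw [← Complex.exp_add]; simp
  rw [modeCoeff_eq l a n]
  refine h4.congr_deriv ?_
  rw [← modeCoeff_eq l a n]
  conv_rhs => rw [modeCoeff_eq l a n]
  linear_combination (3 * Complex.I * (n + 1) * shiftConv (fun i => modeCoeff l a i t) n) * h5

/-! ### Estimates for the modes -/

/-- The exponent is linear in the frequency and frequencies add under convolution, so the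
exponential factors out. -/
lemma norm_shiftConv_le {c : ℕ → ℂ} {M : ℕ → ℝ} {q : ℝ} {n : ℕ}
    (h : ∀ i < n, ‖c i‖ ≤ Real.exp (q * (i + 1)) * M i) :
    ‖shiftConv c n‖ ≤ Real.exp (q * (n + 1)) * shiftConv M n := by
  cases n with
  | zero => simp [shiftConv]
  | succ n =>
    rw [shiftConv, shiftConv, Finset.mul_sum]
    refine (norm_sum_le _ _).trans (Finset.sum_le_sum fun p hp => ?_)
    have hp := Finset.HasAntidiagonal.mem_antidiagonal.1 hp
    rw [norm_mul]
    have h1 := h p.1 (by omega)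
    have h2 := h p.2 (by omega)
    calc ‖c p.1‖ * ‖c p.2‖
        ≤ (Real.exp (q * (p.1 + 1)) * M p.1) * (Real.exp (q * (p.2 + 1)) * M p.2) :=
          mul_le_mul h1 h2 (norm_nonneg _) ((norm_nonneg _).trans h1)
      _ = (Real.exp (q * (p.1 + 1)) * Real.exp (q * (p.2 + 1))) * (M p.1 * M p.2) := by ring
      _ = _ := by
          rw [← Real.exp_add, ← hp]
          push_cast
          ring_nf

/-- The Fourier symbol of `ν (-Δ)^γ + α ∂ₓ³`. -/
noncomputable def symbol (ν γ α : ℝ) (k : ℤ) : ℂ :=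
  ((ν * |(k : ℝ)| ^ (2 * γ) : ℝ) : ℂ) - Complex.I * α * k ^ 3

/-- The dispersive part is purely imaginary, so the decay rates do not see `α`. -/
lemma symbol_re (ν γ α : ℝ) (k : ℤ) : (symbol ν γ α k).re = ν * |(k : ℝ)| ^ (2 * γ) := by
  have : Complex.I * α * (k : ℂ) ^ 3 = ((α * (k : ℝ) ^ 3 : ℝ) : ℂ) * Complex.I := by
    push_cast; ring
  rw [symbol, this, Complex.sub_re, Complex.ofReal_re, Complex.re_ofReal_mul]
  simp

lemma symbol_succ_re (ν γ α : ℝ) (n : ℕ) :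
    (symbol ν γ α (n + 1)).re = ν * ((n : ℝ) + 1) ^ (2 * γ) := by
  rw [symbol_re]
  push_cast
  rw [abs_of_nonneg (by positivity)]

lemma succ_le_rpow {γ : ℝ} (hγ : 1 / 2 < γ) (n : ℕ) : (n : ℝ) + 1 ≤ ((n : ℝ) + 1) ^ (2 * γ) :=
  Real.self_le_rpow_of_one_le (by linarith [n.cast_nonneg (α := ℝ)]) (by linarith)

variable {ν γ ε T : ℝ}

lemma norm_modeCoeff_le_duhamel (hν : 0 < ν) (hγ : 1 / 2 < γ) {α : ℝ} {a : ℕ → ℂ} {M : ℕ → ℝ} {n : ℕ}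
    (h : ∀ i < n, ∀ t ∈ Ico 0 T, ‖modeCoeff (fun n => symbol ν γ α (n + 1)) a i t‖ ≤
      Real.exp (-(ν / 2) * t * (i + 1)) * M i) {t : ℝ} (ht : t ∈ Ico 0 T) :
    ‖modeCoeff (fun n => symbol ν γ α (n + 1)) a n t‖ ≤
      Real.exp (-(ν * ((n : ℝ) + 1) ^ (2 * γ)) * t) * ‖a n‖ +
      Real.exp (-(ν / 2) * t * (n + 1)) * (3 * (n + 1) * shiftConv M n *
        ((1 - Real.exp (-(ν * ((n : ℝ) + 1) ^ (2 * γ) - ν / 2 * (n + 1)) * t)) /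
          (ν * ((n : ℝ) + 1) ^ (2 * γ) - ν / 2 * (n + 1)))) := by
  set l : ℕ → ℂ := fun n => symbol ν γ α (n + 1) with hl
  have hre : (l n).re = ν * ((n : ℝ) + 1) ^ (2 * γ) := symbol_succ_re ν γ α n
  have hk := succ_le_rpow hγ n
  -- The forcing decays at rate `ρ = -(ν/2)k` with `k = n + 1`, inherited from the lower modes; what
  -- remains of the dissipation is `νk^{2γ} - (ν/2)k`.
  have key := norm_le_of_hasDerivAt_linear (T := T) (f := modeCoeff l a n)
    (g := fun t => 3 * Complex.I * (n + 1) * shiftConv (fun i => modeCoeff l a i t) n)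
    (l := l n) (ρ := -(ν / 2) * (n + 1)) (B := 3 * (n + 1) * shiftConv M n)
    (by rw [hre]; have : (0 : ℝ) < n + 1 := by positivity
        nlinarith) (continuous_modeCoeff l a n).continuousOn
    (fun t _ => hasDerivAt_modeCoeff l a n t) (fun t ht => ?_) ht
  · rw [modeCoeff_zero, hre] at key
    refine key.trans (le_of_eq ?_)
    ring_nf
  · have h1 := norm_shiftConv_le (c := fun i => modeCoeff l a i t) (M := M) (q := -(ν / 2) * t)
      (n := n) fun i hi => h i hi t ⟨ht.1.le, ht.2⟩
    have h2 : ‖(3 * Complex.I * (n + 1) : ℂ)‖ = 3 * (n + 1) := by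
      rw [norm_mul, norm_mul, Complex.norm_I]
      have : ‖((n : ℂ) + 1)‖ = n + 1 := by
        rw [← Nat.cast_succ, Complex.norm_natCast]; simp
      rw [this]; simp
    rw [norm_mul, h2]
    calc 3 * ((n : ℝ) + 1) * ‖shiftConv (fun i => modeCoeff l a i t) n‖
        ≤ 3 * ((n : ℝ) + 1) * (Real.exp (-(ν / 2) * t * (n + 1)) * shiftConv M n) := by gcongr
      _ = _ := by ring_nf

/-- Giving up the rate `(ν/2)k` to exponential decay costs at most half of the dissipation, since `k
≤ k^{2γ}` for `k ≥ 1`. -/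
lemma half_rpow_le (hν : 0 < ν) (hγ : 1 / 2 < γ) (n : ℕ) :
    ν / 2 * ((n : ℝ) + 1) ^ (2 * γ) ≤ ν * ((n : ℝ) + 1) ^ (2 * γ) - ν / 2 * (n + 1) := by
  have := succ_le_rpow hγ n
  nlinarith

/-- The modes are dominated by the majorant, with exponential decay in the frequency. -/
lemma norm_modeCoeff_le (hν : 0 < ν) (hγ : 1 / 2 < γ) (hε : 0 ≤ ε)
    (hT : ∀ k x t : ℝ, 1 ≤ k → ν / 2 * k ^ (2 * γ) ≤ x → 0 ≤ t → t ≤ T →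
      3 * k * ((1 - Real.exp (-x * t)) / x) ≤ ε) (α : ℝ) (a : ℕ → ℂ) (n : ℕ) :
    ∀ t ∈ Ico 0 T, ‖modeCoeff (fun n => symbol ν γ α (n + 1)) a n t‖ ≤
      Real.exp (-(ν / 2) * t * (n + 1)) * majorant ε (fun n => ‖a n‖) n := by
  induction n using Nat.strong_induction_on with
  | _ n ih =>
    intro t ht
    have h1 := norm_modeCoeff_le_duhamel hν hγ ih ht
    have h2 := hT (n + 1) _ t (by linarith [n.cast_nonneg (α := ℝ)]) (half_rpow_le hν hγ n) ht.1 ht.2.le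
    set φ := (1 - Real.exp (-(ν * ((n : ℝ) + 1) ^ (2 * γ) - ν / 2 * (n + 1)) * t)) /
          (ν * ((n : ℝ) + 1) ^ (2 * γ) - ν / 2 * (n + 1))
    have hG := shiftConv_nonneg (majorant_nonneg hε (b := fun n => ‖a n‖) fun n => norm_nonneg _) n
    have h3 : Real.exp (-(ν * ((n : ℝ) + 1) ^ (2 * γ)) * t) ≤ Real.exp (-(ν / 2) * t * (n + 1)) := by
      apply Real.exp_le_exp.2
      have := half_rpow_le hν hγ n
      have h5 : 0 ≤ ν / 2 * ((n : ℝ) + 1) ^ (2 * γ) := by positivity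
      have := mul_le_mul_of_nonneg_right (show ν / 2 * ((n : ℝ) + 1) ≤ ν * ((n : ℝ) + 1) ^ (2 * γ) by linarith) ht.1
      linarith
    rw [majorant_eq, mul_add]
    refine h1.trans (add_le_add (by gcongr) ?_)
    refine mul_le_mul_of_nonneg_left ?_ (Real.exp_pos _).le
    calc 3 * ((n : ℝ) + 1) * shiftConv (majorant ε fun n => ‖a n‖) n * φ
        = (3 * ((n : ℝ) + 1) * φ) * shiftConv (majorant ε fun n => ‖a n‖) n := by ring
      _ ≤ _ := mul_le_mul_of_nonneg_right h2 hG

lemma lintegral_exp_le {A x : ℝ} (hA : 0 ≤ A) (hx : 0 < x) (T : ℝ) :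
    ∫⁻ t in Ico 0 T, ENNReal.ofReal (A * Real.exp (-x * t)) ≤ ENNReal.ofReal (A / x) := by
  have h1 : ∫⁻ t in Ioi (0 : ℝ), ENNReal.ofReal (A * Real.exp (-x * t)) = ENNReal.ofReal (A / x) := by
    rw [← ofReal_integral_eq_lintegral_ofReal]
    · rw [integral_const_mul, integral_exp_mul_Ioi (by linarith)]
      simp [div_eq_mul_inv]
    · exact (integrableOn_exp_mul_Ioi (by linarith) 0).const_mul A
    · filter_upwards with t
      positivity
  rw [← h1, setLIntegral_congr (Ioi_ae_eq_Ici (a := (0 : ℝ)))]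
  exact lintegral_mono_set Ico_subset_Ici_self

/-- Parabolic smoothing for a single mode. -/
lemma lintegral_modeCoeff_le (hν : 0 < ν) (hγ : 1 / 2 < γ) {α : ℝ} {a : ℕ → ℂ} {M : ℕ → ℝ}
    (hM : ∀ n, 0 ≤ M n)
    (h : ∀ i, ∀ t ∈ Ico 0 T, ‖modeCoeff (fun n => symbol ν γ α (n + 1)) a i t‖ ≤
      Real.exp (-(ν / 2) * t * (i + 1)) * M i) (n : ℕ) :
    ∫⁻ t in Ico 0 T, ENNReal.ofReal (((n : ℝ) + 1) ^ (2 * γ) *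
        ‖modeCoeff (fun n => symbol ν γ α (n + 1)) a n t‖ ^ 2) ≤
      ENNReal.ofReal (1 / ν * ‖a n‖ ^ 2 + 72 / ν ^ 3 * shiftConv M n ^ 2) := by
  set k : ℝ := (n : ℝ) + 1 with hk
  have hk1 : 1 ≤ k := by rw [hk]; linarith [n.cast_nonneg (α := ℝ)]
  set p := k ^ (2 * γ) with hp
  have hkp : k ≤ p := succ_le_rpow hγ n
  have hp0 : 0 < p := by linarith
  set G := shiftConv M n with hGd
  have hG : 0 ≤ G := shiftConv_nonneg hM n
  -- The Duhamel factor is at most `2/(νp)`; then `(x + y)² ≤ 2x² + 2y²` gives `72 = 2·(3·2)²`.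
  have hpt : ∀ t ∈ Ico 0 T, ENNReal.ofReal (p *
        ‖modeCoeff (fun n => symbol ν γ α (n + 1)) a n t‖ ^ 2) ≤
      ENNReal.ofReal ((2 * p * ‖a n‖ ^ 2) * Real.exp (-(2 * ν * p) * t)) +
      ENNReal.ofReal ((72 * k ^ 2 * G ^ 2 / (ν ^ 2 * p)) * Real.exp (-(ν * k) * t)) := by
    intro t ht
    rw [← ENNReal.ofReal_add (by positivity) (by positivity)]
    apply ENNReal.ofReal_le_ofReal
    have h1 := norm_modeCoeff_le_duhamel hν hγ (n := n) (fun i _ => h i) ht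
    have h2 : 0 < ν * p - ν / 2 * k := by
      have := half_rpow_le hν hγ n
      have : 0 < ν / 2 * p := by positivity
      linarith
    have h3 := (one_sub_exp_div_le h2 ht.1).2.1
    have h4 : 1 / (ν * p - ν / 2 * k) ≤ 2 / (ν * p) := by
      rw [div_le_div_iff₀ h2 (by positivity)]
      have := half_rpow_le hν hγ n
      linarith
    rw [← hk, ← hp, ← hGd] at h1
    set E := Real.exp (-(ν * p) * t) with hE
    set F := Real.exp (-(ν / 2) * t * k) with hF
    have h5 : ‖modeCoeff (fun n => symbol ν γ α (n + 1)) a n t‖ ≤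
        E * ‖a n‖ + F * (3 * k * G * (2 / (ν * p))) := by
      refine h1.trans (add_le_add le_rfl ?_)
      refine mul_le_mul_of_nonneg_left ?_ (Real.exp_pos _).le
      exact mul_le_mul_of_nonneg_left (h3.trans h4) (by positivity)
    have hE2 : Real.exp (-(2 * ν * p) * t) = E ^ 2 := by
      rw [hE, sq, ← Real.exp_add]; ring_nf
    have hF2 : Real.exp (-(ν * k) * t) = F ^ 2 := by
      rw [hF, sq, ← Real.exp_add]; ring_nf
    rw [hE2, hF2]
    calc p * ‖modeCoeff (fun n => symbol ν γ α (n + 1)) a n t‖ ^ 2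
        ≤ p * (E * ‖a n‖ + F * (3 * k * G * (2 / (ν * p)))) ^ 2 := by gcongr
      _ ≤ p * (2 * (E * ‖a n‖) ^ 2 + 2 * (F * (3 * k * G * (2 / (ν * p)))) ^ 2) := by
          gcongr
          nlinarith [sq_nonneg (E * ‖a n‖ - F * (3 * k * G * (2 / (ν * p))))]
      _ = _ := by field_simp; ring
  calc _ ≤ ∫⁻ t in Ico 0 T, (ENNReal.ofReal ((2 * p * ‖a n‖ ^ 2) * Real.exp (-(2 * ν * p) * t)) +
      ENNReal.ofReal ((72 * k ^ 2 * G ^ 2 / (ν ^ 2 * p)) * Real.exp (-(ν * k) * t))) :=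
        setLIntegral_mono (by fun_prop) hpt
    _ ≤ ENNReal.ofReal (2 * p * ‖a n‖ ^ 2 / (2 * ν * p)) +
        ENNReal.ofReal (72 * k ^ 2 * G ^ 2 / (ν ^ 2 * p) / (ν * k)) := by
        rw [lintegral_add_left (by fun_prop)]
        exact add_le_add (lintegral_exp_le (by positivity) (by positivity) T)
          (lintegral_exp_le (by positivity) (by positivity) T)
    _ ≤ _ := by
        rw [← ENNReal.ofReal_add (by positivity) (by positivity)]
        apply ENNReal.ofReal_le_ofReal
        have e1 : 2 * p * ‖a n‖ ^ 2 / (2 * ν * p) = 1 / ν * ‖a n‖ ^ 2 := by field_simp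
        -- Integrating `e^{-νkt}` in time gains a factor `1/k`, which leaves `k/p ≤ 1`. Without this
        -- decay `k²/p` would remain, unbounded for `γ < 1`.
        have e2 : 72 * k ^ 2 * G ^ 2 / (ν ^ 2 * p) / (ν * k) = 72 / ν ^ 3 * G ^ 2 * (k / p) := by
          have : k ≠ 0 := by positivity
          field_simp
        have e3 : k / p ≤ 1 := (div_le_one hp0).2 hkp
        rw [e1, e2]
        have : 72 / ν ^ 3 * G ^ 2 * (k / p) ≤ 72 / ν ^ 3 * G ^ 2 * 1 := by gcongr
        linarith

/-! ### Sequences supported on the positive frequencies -/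

/-- The sequence on `ℤ` with value `c n` at `n + 1` and `0` at the nonpositive integers. -/
def posExtend {X : Type*} [Zero X] (c : ℕ → X) (k : ℤ) : X :=
  if 0 < k then c (k - 1).toNat else 0

section posExtend

variable {X : Type*} [Zero X] (c : ℕ → X)

lemma posExtend_succ (n : ℕ) : posExtend c (n + 1) = c n := by
  have : (0 : ℤ) < n + 1 := by positivity
  simp [posExtend, this]

lemma posExtend_of_nonpos {k : ℤ} (hk : k ≤ 0) : posExtend c k = 0 := if_neg hk.not_gt

lemma nonpos_or_eq_succ (k : ℤ) : k ≤ 0 ∨ ∃ n : ℕ, k = n + 1 := by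
  rcases le_or_gt k 0 with h | h
  · exact Or.inl h
  · exact Or.inr ⟨(k - 1).toNat, by omega⟩

end posExtend

lemma succ_int_injective : Function.Injective fun n : ℕ => ((n : ℤ) + 1) := fun a b h => by
  simpa using h

lemma notMem_range_succ {k : ℤ} (hk : k ∉ range fun n : ℕ => ((n : ℤ) + 1)) : k ≤ 0 := by
  rcases nonpos_or_eq_succ k with h | ⟨n, rfl⟩
  · exact h
  · exact absurd ⟨n, rfl⟩ hk

lemma summable_posExtend {c : ℕ → ℝ} (hc : Summable c) : Summable (posExtend c) := by
  refine (succ_int_injective.summable_iff fun k hk => posExtend_of_nonpos c (notMem_range_succ hk)).1 ?_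
  refine hc.congr fun n => ?_
  exact (posExtend_succ c n).symm

lemma hasSum_posExtend_convolution (c : ℕ → ℂ) (k : ℤ) :
    HasSum (fun j : ℤ => posExtend c j * posExtend c (k - j)) (posExtend (shiftConv c) k) := by
  refine (succ_int_injective.hasSum_iff fun j hj => by
    rw [posExtend_of_nonpos c (notMem_range_succ hj), zero_mul]).1 ?_
  have e : ((fun j : ℤ => posExtend c j * posExtend c (k - j)) ∘ fun n : ℕ => ((n : ℤ) + 1)) =
      fun i : ℕ => c i * posExtend c (k - (i + 1)) := by
    ext i
    simp only [Function.comp_apply, posExtend_succ]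
  rw [e]
  rcases nonpos_or_eq_succ k with h | ⟨n, rfl⟩
  · rw [posExtend_of_nonpos _ h]
    convert hasSum_zero (α := ℂ) (β := ℕ) using 2 with i
    rw [posExtend_of_nonpos c (by omega), mul_zero]
  · rw [posExtend_succ]
    cases n with
    | zero =>
      rw [shiftConv]
      convert hasSum_zero (α := ℂ) (β := ℕ) using 2 with i
      rw [posExtend_of_nonpos c (by push_cast; omega), mul_zero]
    | succ m =>
      rw [shiftConv, Finset.Nat.sum_antidiagonal_eq_sum_range_succ (fun i j => c i * c j)]
      have h0 : ∀ i ∉ Finset.range (m + 1), c i * posExtend c (((m + 1 : ℕ) : ℤ) + 1 - (i + 1)) = 0 := by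
        intro i hi
        rw [Finset.mem_range] at hi
        rw [posExtend_of_nonpos c (by push_cast; omega), mul_zero]
      have hfin := hasSum_sum_of_ne_finset_zero (L := SummationFilter.unconditional ℕ) h0
      have hval : ∀ i ∈ Finset.range m.succ, c i * c (m - i) =
          c i * posExtend c (((m + 1 : ℕ) : ℤ) + 1 - (i + 1)) := by
        intro i hi
        rw [Finset.mem_range] at hi
        rw [show ((m + 1 : ℕ) : ℤ) + 1 - (i + 1) = ((m - i : ℕ) : ℤ) + 1 by omega, posExtend_succ]
      rw [Finset.sum_congr rfl hval]
      exact hfin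

/-! ### Testing the equation against exponentials -/

lemma MemH.norm_fourierCoeff_le_normH {s : ℝ} (hs : 0 ≤ s) {f : L2Torus} (hf : MemH s f) (k : ℤ) :
    ‖fourierCoeff f k‖ ≤ normH s f := by
  apply Real.le_sqrt_of_sq_le
  have h1 := hf.le_tsum k fun j _ => by positivity
  refine le_trans ?_ h1
  have : (1 : ℝ) ≤ (1 + (k : ℝ) ^ 2) ^ s := Real.one_le_rpow (by nlinarith [sq_nonneg (k : ℝ)]) hs
  nlinarith [sq_nonneg ‖fourierCoeff f k‖]

lemma MemH.sub {s : ℝ} {f g : L2Torus} (hf : MemH s f) (hg : MemH s g) : MemH s (f - g) := by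
  refine Summable.of_nonneg_of_le (fun k => by positivity) (fun k => ?_)
    ((Summable.mul_left 2 hf).add (Summable.mul_left 2 hg))
  rw [fourierCoeff_sub]
  have h1 := norm_sub_le (fourierCoeff f k) (fourierCoeff g k)
  have h2 : ‖fourierCoeff f k - fourierCoeff g k‖ ^ 2 ≤
      2 * ‖fourierCoeff f k‖ ^ 2 + 2 * ‖fourierCoeff g k‖ ^ 2 := by
    nlinarith [sq_nonneg (‖fourierCoeff f k‖ - ‖fourierCoeff g k‖),
      norm_nonneg (fourierCoeff f k - fourierCoeff g k)]
  calc (1 + (k : ℝ) ^ 2) ^ s * ‖fourierCoeff f k - fourierCoeff g k‖ ^ 2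
      ≤ (1 + (k : ℝ) ^ 2) ^ s * (2 * ‖fourierCoeff f k‖ ^ 2 + 2 * ‖fourierCoeff g k‖ ^ 2) := by
        gcongr
    _ = _ := by ring

lemma iteratedDeriv_exp (n : ℕ) (k : ℤ) :
    iteratedDeriv n (fun x : ℝ => Complex.exp (-(Complex.I * k * x))) =
      fun x : ℝ => (-(Complex.I * k)) ^ n * Complex.exp (-(Complex.I * k * x)) := by
  induction n with
  | zero => simp
  | succ n ih =>
    rw [iteratedDeriv_succ, ih]
    ext x
    have h := (hasDerivAt_cexp_mul (-(Complex.I * k)) x).const_mul ((-(Complex.I * k)) ^ n)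
    simp only [neg_mul] at h
    rw [h.deriv]
    ring

lemma pairing_const_mul (h : Torus → ℂ) (a : ℂ) (φ : ℝ → ℂ) :
    pairing h (fun x => a * φ x) = a * pairing h φ := by
  unfold pairing
  rw [← intervalIntegral.integral_const_mul]
  congr 1
  ext x
  ring

variable {ν γ α s T : ℝ}

/-- The equation for a single Fourier mode. -/
lemma SolvesEquation.hasDerivAt_fourierCoeff {u : ℝ → L2Torus} (h : SolvesEquation ν γ α T u)
    (k : ℤ) {t : ℝ} (ht : t ∈ Ioo 0 T) :
    HasDerivAt (fun τ => fourierCoeff (u τ) k) (-symbol ν γ α k * fourierCoeff (u t) k +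
      3 * Complex.I * k * fourierCoeff (fun x => u t x ^ 2) k) t := by
  have h1 := h _ (isTestFunction_exp k) t ht
  rw [fracLaplacian_exp, ← iteratedDeriv_one, iteratedDeriv_exp, iteratedDeriv_exp,
    pairing_const_mul, pairing_const_mul, pairing_const_mul] at h1
  simp only [pairing_exp] at h1
  have hpi : (2 * π : ℂ) ≠ 0 := by
    have : (π : ℂ) ≠ 0 := by exact_mod_cast Real.pi_ne_zero
    simp
  have h2 := h1.const_mul ((2 * π : ℂ)⁻¹)
  have h3 : (fun τ => (2 * π : ℂ)⁻¹ * (2 * π * fourierCoeff (u τ) k)) =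
      fun τ => fourierCoeff (u τ) k := by
    ext τ
    field_simp
  rw [h3] at h2
  refine h2.congr_deriv ?_
  rw [symbol]
  push_cast
  field_simp
  linear_combination (-α * k ^ 3 * Complex.I * fourierCoeff (u t) k) * Complex.I_sq

/-! ### Uniqueness -/

lemma ContinuousIntoH.continuousOn_fourierCoeff {J : Set ℝ} {u : ℝ → L2Torus} (hs : 0 ≤ s)
    (h : ContinuousIntoH s J u) (k : ℤ) : ContinuousOn (fun t => fourierCoeff (u t) k) J := by
  intro t₀ ht₀
  rw [ContinuousWithinAt, tendsto_iff_norm_sub_tendsto_zero]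
  refine squeeze_zero' (Eventually.of_forall fun t => norm_nonneg _) ?_ (h.2 t₀ ht₀)
  filter_upwards [self_mem_nhdsWithin] with t ht
  rw [← fourierCoeff_sub]
  exact ((h.1 t ht).sub (h.1 t₀ ht₀)).norm_fourierCoeff_le_normH hs k

/-- `∑ₖ |f̂(k)|` is bounded by the `H^s` norm. -/
lemma exists_tsum_norm_fourierCoeff_le (hs : 1 / 2 < s) : ∃ C : ℝ, 0 ≤ C ∧ ∀ f : L2Torus, MemH s f →
    Summable (fun k => ‖fourierCoeff f k‖) ∧ ∑' k, ‖fourierCoeff f k‖ ≤ C + normH s f ^ 2 := by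
  have hZ := summable_inv_one_add_sq_rpow hs
  refine ⟨∑' k : ℤ, ((1 + (k : ℝ) ^ 2) ^ s)⁻¹, tsum_nonneg fun k => by positivity, fun f hf => ?_⟩
  have hle : ∀ k : ℤ, ‖fourierCoeff f k‖ ≤ ((1 + (k : ℝ) ^ 2) ^ s)⁻¹ +
      (1 + (k : ℝ) ^ 2) ^ s * ‖fourierCoeff f k‖ ^ 2 := by
    intro k
    have hw : 0 < (1 + (k : ℝ) ^ 2) ^ s := by positivity
    set w := (1 + (k : ℝ) ^ 2) ^ s
    set y := ‖fourierCoeff f k‖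
    have hy : 0 ≤ y := norm_nonneg _
    -- Completing the square yields `y ≤ w⁻¹ + wy²`, used in place of Cauchy–Schwarz.
    have : w⁻¹ + w * y ^ 2 - y = w * ((w⁻¹ - y / 2) ^ 2 + 3 / 4 * y ^ 2) := by
      field_simp; ring
    have : 0 ≤ w * ((w⁻¹ - y / 2) ^ 2 + 3 / 4 * y ^ 2) := by positivity
    linarith
  have hs1 : Summable fun k => ‖fourierCoeff f k‖ :=
    Summable.of_nonneg_of_le (fun k => norm_nonneg _) hle (hZ.add hf)
  refine ⟨hs1, (hs1.tsum_le_tsum hle (hZ.add hf)).trans (le_of_eq ?_)⟩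
  rw [hZ.tsum_add hf, normH, Real.sq_sqrt (tsum_nonneg fun k => by positivity)]

lemma normH_le_add {f g : L2Torus} (hf : MemH s f) (hg : MemH s g) :
    normH s f ^ 2 ≤ 2 * normH s (f - g) ^ 2 + 2 * normH s g ^ 2 := by
  have hfg := hf.sub hg
  unfold normH
  rw [Real.sq_sqrt (tsum_nonneg fun k => by positivity),
    Real.sq_sqrt (tsum_nonneg fun k => by positivity),
    Real.sq_sqrt (tsum_nonneg fun k => by positivity), ← tsum_mul_left, ← tsum_mul_left,
    ← (Summable.mul_left 2 hfg).tsum_add (Summable.mul_left 2 hg)]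
  refine hf.tsum_le_tsum (fun k => ?_) ((Summable.mul_left 2 hfg).add (Summable.mul_left 2 hg))
  rw [fourierCoeff_sub]
  have h1 := norm_add_le (fourierCoeff f k - fourierCoeff g k) (fourierCoeff g k)
  rw [sub_add_cancel] at h1
  have h2 : ‖fourierCoeff f k‖ ^ 2 ≤
      2 * ‖fourierCoeff f k - fourierCoeff g k‖ ^ 2 + 2 * ‖fourierCoeff g k‖ ^ 2 := by
    nlinarith [sq_nonneg (‖fourierCoeff f k - fourierCoeff g k‖ - ‖fourierCoeff g k‖),
      norm_nonneg (fourierCoeff f k)]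
  calc (1 + (k : ℝ) ^ 2) ^ s * ‖fourierCoeff f k‖ ^ 2
      ≤ (1 + (k : ℝ) ^ 2) ^ s *
        (2 * ‖fourierCoeff f k - fourierCoeff g k‖ ^ 2 + 2 * ‖fourierCoeff g k‖ ^ 2) := by gcongr
    _ = _ := by ring

/-- Continuity gives local boundedness and compactness makes it uniform. The interval stops at `T' <
T` because nothing is known at `T`. -/
lemma ContinuousIntoH.exists_normH_sq_le {u : ℝ → L2Torus} (h : ContinuousIntoH s (Ico 0 T) u)
    {T' : ℝ} (hT' : T' < T) : ∃ C : ℝ, ∀ t ∈ Icc 0 T', normH s (u t) ^ 2 ≤ C := by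
  have hsub : Icc 0 T' ⊆ Ico 0 T := fun t ht => ⟨ht.1, ht.2.trans_lt hT'⟩
  refine isCompact_Icc.induction_on (p := fun S => ∃ C : ℝ, ∀ t ∈ S, normH s (u t) ^ 2 ≤ C)
    ⟨0, by simp⟩ ?_ ?_ ?_
  · rintro S S' hSS ⟨C, hC⟩
    exact ⟨C, fun t ht => hC t (hSS ht)⟩
  · rintro S S' ⟨C, hC⟩ ⟨C', hC'⟩
    refine ⟨max C C', fun t ht => ?_⟩
    rcases ht with ht | ht
    · exact (hC t ht).trans (le_max_left _ _)
    · exact (hC' t ht).trans (le_max_right _ _)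
  · intro t₀ ht₀
    have h1 := (h.2 t₀ (hsub ht₀)).mono_left (nhdsWithin_mono t₀ hsub)
    have h2 : {t | normH s (u t - u t₀) < 1} ∈ 𝓝[Icc 0 T'] t₀ := h1.eventually (gt_mem_nhds one_pos)
    refine ⟨_, inter_mem h2 self_mem_nhdsWithin, 2 + 2 * normH s (u t₀) ^ 2, fun t ht => ?_⟩
    have h3 := normH_le_add (h.1 t (hsub ht.2)) (h.1 t₀ (hsub ht₀))
    have h4 : normH s (u t - u t₀) < 1 := ht.1
    have h5 : 0 ≤ normH s (u t - u t₀) := Real.sqrt_nonneg _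
    nlinarith

/-- Convolution maps `ℓ¹ × ℓ^∞` to `ℓ^∞`, applied to the two terms of `f·f - g·g = f·(f - g) + (f -
g)·g`. -/
lemma norm_fourierCoeff_sq_sub_le {f g : L2Torus} {A B : ℝ}
    (hf : Summable fun k => ‖fourierCoeff f k‖) (hg : Summable fun k => ‖fourierCoeff g k‖)
    (hfA : ∑' k, ‖fourierCoeff f k‖ ≤ A) (hgA : ∑' k, ‖fourierCoeff g k‖ ≤ A)
    (hB : ∀ k, ‖fourierCoeff f k - fourierCoeff g k‖ ≤ B) (k : ℤ) :
    ‖fourierCoeff (fun x => f x ^ 2) k - fourierCoeff (fun x => g x ^ 2) k‖ ≤ 2 * A * B := by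
  have hB0 : 0 ≤ B := (norm_nonneg _).trans (hB 0)
  have h1 := (hasSum_fourierCoeff_sq f k).sub (hasSum_fourierCoeff_sq g k)
  have hg' : Summable fun j => ‖fourierCoeff g (k - j)‖ :=
    ((Equiv.subLeft k).summable_iff (f := fun j => ‖fourierCoeff g j‖)).2 hg
  have hgt : ∑' j, ‖fourierCoeff g (k - j)‖ = ∑' j, ‖fourierCoeff g j‖ :=
    (Equiv.subLeft k).tsum_eq (fun j => ‖fourierCoeff g j‖)
  have hb : HasSum (fun j => ‖fourierCoeff f j‖ * B + B * ‖fourierCoeff g (k - j)‖)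
      ((∑' k, ‖fourierCoeff f k‖) * B + B * ∑' k, ‖fourierCoeff g k‖) := by
    rw [← hgt]
    exact (hf.hasSum.mul_right B).add (hg'.hasSum.mul_left B)
  rw [← h1.tsum_eq]
  refine (tsum_of_norm_bounded hb fun j => ?_).trans ?_
  · have e : fourierCoeff f j * fourierCoeff f (k - j) - fourierCoeff g j * fourierCoeff g (k - j) =
        fourierCoeff f j * (fourierCoeff f (k - j) - fourierCoeff g (k - j)) +
          (fourierCoeff f j - fourierCoeff g j) * fourierCoeff g (k - j) := by ring
    rw [e]
    refine (norm_add_le _ _).trans ?_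
    rw [norm_mul, norm_mul]
    gcongr
    · exact hB _
    · exact hB _
  · nlinarith

/-- The argument takes place in `ℓ^∞` over the frequencies with the weight `e^{-κt}`: a large `κ`
replaces the short time that a contraction would otherwise need, so all of `[0, T']` is covered at
once. -/
theorem IsSolution.unique (hν : 0 < ν) (hγ : 1 / 2 < γ) (hs : 1 / 2 < s) {u₀ : L2Torus}
    {u v : ℝ → L2Torus} (hu : IsSolution ν γ α s T u₀ u) (hv : IsSolution ν γ α s T u₀ v)
    {t : ℝ} (ht : t ∈ Ico 0 T) : v t = u t := by
  obtain ⟨T', htT', hT'⟩ := exists_between ht.2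
  have hT'0 : 0 ≤ T' := ht.1.trans htT'.le
  have hsub : Icc 0 T' ⊆ Ico 0 T := fun t ht => ⟨ht.1, ht.2.trans_lt hT'⟩
  obtain ⟨Cu, hCu⟩ := hu.continuousInto.exists_normH_sq_le hT'
  obtain ⟨Cv, hCv⟩ := hv.continuousInto.exists_normH_sq_le hT'
  obtain ⟨C, hC0, hC⟩ := exists_tsum_norm_fourierCoeff_le hs
  set A := C + max (max Cu Cv) 0 + 1 with hA
  have hA0 : 0 < A := by have := le_max_right (max Cu Cv) 0; linarith
  have hu1 : ∀ t ∈ Icc 0 T', Summable (fun k => ‖fourierCoeff (u t) k‖) ∧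
      ∑' k, ‖fourierCoeff (u t) k‖ ≤ A := fun t ht => by
    obtain ⟨h1, h2⟩ := hC (u t) (hu.continuousInto.1 t (hsub ht))
    have := hCu t ht
    have := le_max_left Cu Cv
    have := le_max_left (max Cu Cv) 0
    exact ⟨h1, by linarith⟩
  have hv1 : ∀ t ∈ Icc 0 T', Summable (fun k => ‖fourierCoeff (v t) k‖) ∧
      ∑' k, ‖fourierCoeff (v t) k‖ ≤ A := fun t ht => by
    obtain ⟨h1, h2⟩ := hC (v t) (hv.continuousInto.1 t (hsub ht))
    have := hCv t ht
    have := le_max_right Cu Cv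
    have := le_max_left (max Cu Cv) 0
    exact ⟨h1, by linarith⟩
  -- The choice of `K` and `κ` makes `|k| / (Re l + κ) ≤ 1/(12A)`; the nonlinearity contributes
  -- `3|k|·2AB`, and `6AB/(12A) = B/2`.
  obtain ⟨K, hK, hk⟩ := exists_le_mul_rpow_add hγ (η := ν / (12 * A)) (by positivity)
  set κ := 12 * A * K with hκ
  have hκ0 : 0 < κ := by positivity
  set w : ℤ → ℝ → ℂ := fun k t => fourierCoeff (v t) k - fourierCoeff (u t) k with hw
  have hstep : ∀ B : ℝ, (∀ k, ∀ t ∈ Ico 0 T', ‖w k t‖ ≤ B * Real.exp (κ * t)) →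
      ∀ k, ∀ t ∈ Ico 0 T', ‖w k t‖ ≤ B / 2 * Real.exp (κ * t) := by
    intro B hB k t ht
    have hB0 : 0 ≤ B := by
      have := (norm_nonneg _).trans (hB 0 t ht)
      exact nonneg_of_mul_nonneg_left this (Real.exp_pos _)
    have hre := symbol_re ν γ α k
    have hp : 0 ≤ ν * |(k : ℝ)| ^ (2 * γ) := by positivity
    have hpos : 0 < (symbol ν γ α k).re + κ := by rw [hre]; linarith
    have key := norm_le_of_hasDerivAt_linear (T := T') (f := w k)
      (g := fun t => 3 * Complex.I * k * (fourierCoeff (fun x => v t x ^ 2) k -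
        fourierCoeff (fun x => u t x ^ 2) k)) (l := symbol ν γ α k) (ρ := κ)
      (B := 3 * |(k : ℝ)| * (2 * A * B)) hpos
      (((hv.continuousInto.continuousOn_fourierCoeff (by linarith) k).sub
        (hu.continuousInto.continuousOn_fourierCoeff (by linarith) k)).mono hsub) ?_ ?_ ht
    · have h0 : w k 0 = 0 := by simp only [hw, hu.initial, hv.initial, sub_self]
      rw [h0, norm_zero, mul_zero, zero_add] at key
      refine key.trans ?_
      have h1 := (one_sub_exp_div_le hpos ht.1).2.1
      have h2 := hk |(k : ℝ)| (abs_nonneg _)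
      have h3 : |(k : ℝ)| * (1 / ((symbol ν γ α k).re + κ)) ≤ 1 / (12 * A) := by
        rw [mul_one_div, div_le_div_iff₀ hpos (by positivity), hre]
        have : ν / (12 * A) * |(k : ℝ)| ^ (2 * γ) * (12 * A) = ν * |(k : ℝ)| ^ (2 * γ) := by
          field_simp
        nlinarith
      calc _ ≤ 3 * |(k : ℝ)| * (2 * A * B) * Real.exp (κ * t) * (1 / ((symbol ν γ α k).re + κ)) := by
            gcongr
        _ = (|(k : ℝ)| * (1 / ((symbol ν γ α k).re + κ))) * (6 * A * B * Real.exp (κ * t)) := by ring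
        _ ≤ 1 / (12 * A) * (6 * A * B * Real.exp (κ * t)) := by gcongr
        _ = _ := by field_simp; ring
    · intro t ht
      have ht' : t ∈ Ioo 0 T := ⟨ht.1, ht.2.trans hT'⟩
      refine ((hv.equation.hasDerivAt_fourierCoeff k ht').sub
        (hu.equation.hasDerivAt_fourierCoeff k ht')).congr_deriv ?_
      ring
    · intro t ht
      have ht' : t ∈ Icc 0 T' := Ioo_subset_Icc_self ht
      have h1 := norm_fourierCoeff_sq_sub_le (hv1 t ht').1 (hu1 t ht').1 (hv1 t ht').2 (hu1 t ht').2
        (fun k => hB k t ⟨ht.1.le, ht.2⟩) k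
      have h2 : ‖(3 * Complex.I * k : ℂ)‖ = 3 * |(k : ℝ)| := by
        rw [norm_mul, norm_mul, Complex.norm_I, Complex.norm_intCast]; simp
      rw [norm_mul, h2]
      calc _ ≤ 3 * |(k : ℝ)| * (2 * A * (B * Real.exp (κ * t))) := by gcongr
        _ = _ := by ring
  have h0 : ∀ k, ∀ t ∈ Ico 0 T', ‖w k t‖ ≤ (2 * A) * Real.exp (κ * t) := by
    intro k t ht
    have ht' : t ∈ Icc 0 T' := Ico_subset_Icc_self ht
    have h1 := ((hu1 t ht').1.le_tsum k fun _ _ => norm_nonneg _).trans (hu1 t ht').2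
    have h2 := ((hv1 t ht').1.le_tsum k fun _ _ => norm_nonneg _).trans (hv1 t ht').2
    have h3 := norm_sub_le (fourierCoeff (v t) k) (fourierCoeff (u t) k)
    have h4 : 1 ≤ Real.exp (κ * t) := Real.one_le_exp (mul_nonneg hκ0.le ht.1)
    have h5 : ‖w k t‖ ≤ 2 * A := h3.trans (by linarith)
    nlinarith
  have hiter : ∀ n : ℕ, ∀ k, ∀ t ∈ Ico 0 T', ‖w k t‖ ≤ (2 * A) * (1 / 2) ^ n * Real.exp (κ * t) := by
    intro n
    induction n with
    | zero => simpa using h0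
    | succ n ih =>
      intro k t ht
      refine (hstep _ ih k t ht).trans (le_of_eq ?_)
      ring
  refine L2Torus_ext fun k => ?_
  have hlim : Tendsto (fun n : ℕ => (2 * A) * (1 / 2 : ℝ) ^ n * Real.exp (κ * t)) atTop (𝓝 0) := by
    have := ((tendsto_pow_atTop_nhds_zero_of_lt_one (r := (1 / 2 : ℝ)) (by norm_num)
      (by norm_num)).const_mul (2 * A)).mul_const (Real.exp (κ * t))
    simpa using this
  have h2 : ‖w k t‖ ≤ 0 := ge_of_tendsto' hlim fun n => hiter n k t ⟨ht.1, htT'⟩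
  exact sub_eq_zero.1 (norm_le_zero_iff.1 h2)

/-! ### Existence -/

lemma weight_mul_norm_posExtend_sq (s : ℝ) (c : ℕ → ℂ) (k : ℤ) :
    (1 + (k : ℝ) ^ 2) ^ s * ‖posExtend c k‖ ^ 2 =
      posExtend (fun n => weight s n * ‖c n‖ ^ 2) k := by
  rcases nonpos_or_eq_succ k with h | ⟨n, rfl⟩
  · rw [posExtend_of_nonpos _ h, posExtend_of_nonpos _ h]; simp
  · rw [posExtend_succ, posExtend_succ, weight]; push_cast; rfl

lemma posExtend_mono {f g : ℕ → ℝ} (h : ∀ n, f n ≤ g n) (k : ℤ) : posExtend f k ≤ posExtend g k := by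
  unfold posExtend
  split_ifs
  · exact h _
  · exact le_rfl

lemma posExtend_sub (c d : ℕ → ℂ) (k : ℤ) :
    posExtend c k - posExtend d k = posExtend (fun n => c n - d n) k := by
  unfold posExtend
  split_ifs <;> simp

lemma continuous_posExtend {c : ℕ → ℝ → ℂ} (h : ∀ n, Continuous (c n)) (k : ℤ) :
    Continuous fun t => posExtend (fun n => c n t) k := by
  unfold posExtend
  split_ifs
  · exact h _
  · exact continuous_const

/-- A curve in `L²(𝐓)` with Fourier modes `cₙ(t)`, dominated by a sequence in the weighted `ℓ²`,
is continuous into `H^s`. -/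
lemma continuousIntoH_of_modes {s : ℝ} {J : Set ℝ} {c : ℕ → ℝ → ℂ} {M : ℕ → ℝ} {u : ℝ → L2Torus}
    (hu : ∀ t ∈ J, ∀ k, fourierCoeff (u t) k = posExtend (fun n => c n t) k)
    (hc : ∀ n, Continuous (c n)) (hM : Summable fun n => weight s n * M n ^ 2)
    (hcM : ∀ n, ∀ t ∈ J, ‖c n t‖ ≤ M n) : ContinuousIntoH s J u := by
  have hw := weight_pos s
  refine ⟨fun t ht => ?_, fun t₀ ht₀ => ?_⟩
  · have : ∀ k : ℤ, (1 + (k : ℝ) ^ 2) ^ s * ‖fourierCoeff (u t) k‖ ^ 2 ≤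
        posExtend (fun n => weight s n * M n ^ 2) k := by
      intro k
      rw [hu t ht, weight_mul_norm_posExtend_sq]
      refine posExtend_mono (fun n => ?_) k
      have := hw n
      have := hcM n t ht
      gcongr
    exact Summable.of_nonneg_of_le (fun k => by positivity) this (summable_posExtend hM)
  · have hbound : Summable (posExtend fun n => 4 * (weight s n * M n ^ 2)) :=
      summable_posExtend (hM.mul_left 4)
    have hlim : Tendsto (fun t => ∑' k : ℤ, (1 + (k : ℝ) ^ 2) ^ s *
        ‖fourierCoeff (u t - u t₀ : L2Torus) k‖ ^ 2) (𝓝[J] t₀) (𝓝 (∑' _ : ℤ, 0)) := by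
      -- Each mode is continuous, and `|cₙ(t) - cₙ(t₀)| ≤ 2Mₙ` supplies the dominating series
      -- `4wₙMₙ²`.
      refine tendsto_tsum_of_dominated_convergence hbound (fun k => ?_) ?_
      · have hcont := (continuous_posExtend hc k).tendsto t₀
        have h1 : Tendsto (fun t => (1 + (k : ℝ) ^ 2) ^ s * ‖posExtend (fun n => c n t) k -
            posExtend (fun n => c n t₀) k‖ ^ 2) (𝓝[J] t₀) (𝓝 0) := by
          have := (((hcont.sub_const (posExtend (fun n => c n t₀) k)).norm.pow 2).const_mul ((1 + (k : ℝ) ^ 2) ^ s)).mono_left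
            (nhdsWithin_le_nhds (s := J))
          simpa using this
        refine h1.congr' ?_
        filter_upwards [self_mem_nhdsWithin] with t ht
        rw [fourierCoeff_sub, hu t ht, hu t₀ ht₀]
      · filter_upwards [self_mem_nhdsWithin] with t ht k
        rw [Real.norm_of_nonneg (by positivity), fourierCoeff_sub, hu t ht, hu t₀ ht₀,
          posExtend_sub, weight_mul_norm_posExtend_sq]
        refine posExtend_mono (fun n => ?_) k
        have h0 := hw n
        have h1 : ‖c n t - c n t₀‖ ≤ 2 * M n := by
          linarith [norm_sub_le (c n t) (c n t₀), hcM n t ht, hcM n t₀ ht₀]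
        calc weight s n * ‖c n t - c n t₀‖ ^ 2 ≤ weight s n * (2 * M n) ^ 2 := by gcongr
          _ = _ := by ring
    rw [tsum_zero] at hlim
    have := hlim.sqrt
    rwa [Real.sqrt_zero] at this

lemma sqIntegrableIntoHomH_of_modes {s γ D : ℝ} {J : Set ℝ} (hJ : MeasurableSet J)
    {c : ℕ → ℝ → ℂ} {M : ℕ → ℝ} {u : ℝ → L2Torus} (hs : 0 ≤ s)
    (hu : ∀ t ∈ J, ∀ k, fourierCoeff (u t) k = posExtend (fun n => c n t) k)
    (hc : ∀ n, Continuous (c n)) (hM : Summable fun n => weight s n * M n ^ 2)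
    (hcM : ∀ n : ℕ, ∫⁻ t in J, ENNReal.ofReal (((n : ℝ) + 1) ^ (2 * γ) * ‖c n t‖ ^ 2) ≤
      ENNReal.ofReal (D * M n ^ 2)) : SqIntegrableIntoHomH (s + γ) J u := by
  have hw := weight_pos s
  refine ⟨fun k => ?_, ?_⟩
  · refine (continuous_posExtend hc k).aestronglyMeasurable.congr ?_
    exact ae_restrict_of_forall_mem hJ fun t ht => (hu t ht k).symm
  have e : ∫⁻ t in J, homNormSq (s + γ) (u t) = ∫⁻ t in J, ∑' k : {k : ℤ // k ≠ 0},
      ENNReal.ofReal (|((k : ℤ) : ℝ)| ^ (2 * (s + γ)) * ‖posExtend (fun n => c n t) (k : ℤ)‖ ^ 2) := by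
    refine setLIntegral_congr_fun hJ fun t ht => ?_
    simp only [homNormSq, hu t ht]
  rw [e, lintegral_tsum fun k => by
    have := continuous_posExtend hc k
    refine Measurable.aemeasurable (Measurable.ennreal_ofReal ?_)
    exact (continuous_const.mul (this.norm.pow 2)).measurable]
  have hmain : ∀ k : ℤ, ∫⁻ t in J,
      ENNReal.ofReal (|(k : ℝ)| ^ (2 * (s + γ)) * ‖posExtend (fun n => c n t) k‖ ^ 2) ≤
      ENNReal.ofReal (posExtend (fun n => D * (weight s n * M n ^ 2)) k) := by
    intro k
    rcases nonpos_or_eq_succ k with h | ⟨n, rfl⟩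
    · simp [posExtend_of_nonpos _ h]
    · simp only [posExtend_succ]
      have hk : |(((n : ℤ) + 1 : ℤ) : ℝ)| = (n : ℝ) + 1 := by
        push_cast
        exact abs_of_nonneg (by positivity)
      have hpow : ((n : ℝ) + 1) ^ (2 * (s + γ)) ≤ weight s n * ((n : ℝ) + 1) ^ (2 * γ) := by
        rw [mul_add, Real.rpow_add (by positivity), Real.rpow_mul (by positivity), weight]
        gcongr
        rw [Real.rpow_two]
        linarith
      rw [hk]
      calc ∫⁻ t in J, ENNReal.ofReal (((n : ℝ) + 1) ^ (2 * (s + γ)) * ‖c n t‖ ^ 2)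
          ≤ ∫⁻ t in J, ENNReal.ofReal (weight s n) *
              ENNReal.ofReal (((n : ℝ) + 1) ^ (2 * γ) * ‖c n t‖ ^ 2) := by
            refine lintegral_mono fun t => ?_
            rw [← ENNReal.ofReal_mul (hw n).le, ← mul_assoc]
            apply ENNReal.ofReal_le_ofReal
            gcongr
        _ = ENNReal.ofReal (weight s n) *
              ∫⁻ t in J, ENNReal.ofReal (((n : ℝ) + 1) ^ (2 * γ) * ‖c n t‖ ^ 2) :=
            lintegral_const_mul' _ _ ENNReal.ofReal_ne_top
        _ ≤ ENNReal.ofReal (weight s n) * ENNReal.ofReal (D * M n ^ 2) := by gcongr; exact hcM n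
        _ = _ := by
            rw [← ENNReal.ofReal_mul (hw n).le]
            ring_nf
  have hsum := summable_posExtend (hM.mul_left D)
  calc _ ≤ ∑' k : {k : ℤ // k ≠ 0},
        ENNReal.ofReal (posExtend (fun n => D * (weight s n * M n ^ 2)) (k : ℤ)) :=
        ENNReal.tsum_le_tsum fun k => hmain k
    _ ≤ ∑' k : ℤ, ENNReal.ofReal (posExtend (fun n => D * (weight s n * M n ^ 2)) k) :=
        ENNReal.tsum_comp_le_tsum_of_injective Subtype.val_injective _
    _ < ⊤ := hsum.tsum_ofReal_lt_top

/-! ### From the modes to the distributional equation. -/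

lemma hasDerivAt_posExtend_modeCoeff (ν γ α : ℝ) (a : ℕ → ℂ) (m : ℤ) (t : ℝ) :
    HasDerivAt (fun τ => posExtend (fun n => modeCoeff (fun n => symbol ν γ α (n + 1)) a n τ) m)
      (-symbol ν γ α m * posExtend (fun n => modeCoeff (fun n => symbol ν γ α (n + 1)) a n t) m +
        3 * Complex.I * m *
          posExtend (shiftConv fun n => modeCoeff (fun n => symbol ν γ α (n + 1)) a n t) m) t := by
  rcases nonpos_or_eq_succ m with h | ⟨n, rfl⟩
  · simp only [posExtend_of_nonpos _ h, mul_zero, add_zero]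
    exact hasDerivAt_const t 0
  · simp only [posExtend_succ]
    refine (hasDerivAt_modeCoeff (fun n => symbol ν γ α (n + 1)) a n t).congr_deriv ?_
    push_cast
    ring

/-- The integer exponent dominates both `|k|^{2γ}` and `|k|³`, to be paired with the rapid decay of
test function coefficients. -/
lemma norm_symbol_le {ν : ℝ} (hν : 0 ≤ ν) (γ α : ℝ) (n : ℕ) :
    ‖symbol ν γ α (n + 1)‖ ≤ (ν + |α|) * ((n : ℝ) + 1) ^ (⌈2 * γ⌉₊ + 3) := by
  have h1 : (1 : ℝ) ≤ (n : ℝ) + 1 := by linarith [n.cast_nonneg (α := ℝ)]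
  have h2 : ((n : ℝ) + 1) ^ (2 * γ) ≤ ((n : ℝ) + 1) ^ (⌈2 * γ⌉₊ + 3) := by
    rw [← Real.rpow_natCast]
    refine Real.rpow_le_rpow_of_exponent_le h1 ?_
    push_cast
    linarith [Nat.le_ceil (2 * γ)]
  have h3 : ((n : ℝ) + 1) ^ 3 ≤ ((n : ℝ) + 1) ^ (⌈2 * γ⌉₊ + 3) :=
    pow_le_pow_right₀ h1 (by omega)
  have e : ‖((n : ℂ) + 1)‖ = (n : ℝ) + 1 := by
    rw [← Nat.cast_succ, Complex.norm_natCast]; simp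
  unfold symbol
  refine (norm_sub_le _ _).trans ?_
  rw [norm_mul, norm_mul, Complex.norm_I, norm_pow, Complex.norm_real, Complex.norm_real,
    Real.norm_of_nonneg (by positivity), Real.norm_eq_abs]
  push_cast
  rw [e, abs_of_nonneg (by positivity : (0 : ℝ) ≤ (n : ℝ) + 1), one_mul, add_mul]
  gcongr

/-- The pairing is a Fourier series that can be differentiated term by term: uniformly bounded modes
and convolutions have derivatives of polynomial growth in the frequency, which the test function
absorbs. Matching coefficients recovers the right-hand side. -/
lemma solvesEquation_of_modes {ν γ α T C : ℝ} (hν : 0 ≤ ν) (hγ : 0 < γ) {a : ℕ → ℂ} {u : ℝ → L2Torus}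
    (hu : ∀ t ∈ Ico 0 T, ∀ k, fourierCoeff (u t) k =
      posExtend (fun n => modeCoeff (fun n => symbol ν γ α (n + 1)) a n t) k)
    (hC : ∀ n, ∀ t ∈ Ico 0 T, ‖modeCoeff (fun n => symbol ν γ α (n + 1)) a n t‖ ≤ C)
    (hC' : ∀ n, ∀ t ∈ Ico 0 T,
      ‖shiftConv (fun n => modeCoeff (fun n => symbol ν γ α (n + 1)) a n t) n‖ ≤ C) :
    SolvesEquation ν γ α T u := by
  intro φ hφ t ht
  set c : ℕ → ℝ → ℂ := modeCoeff (fun n => symbol ν γ α (n + 1)) a with hcdef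
  have hT : Ioo 0 T ⊆ Ico 0 T := Ioo_subset_Ico_self
  have hC0 : 0 ≤ C := (norm_nonneg _).trans (hC 0 t (hT ht))
  set p := ⌈2 * γ⌉₊ + 3 with hp
  let d : ℤ → ℝ → ℂ := fun m t => -symbol ν γ α m * posExtend (fun n => c n t) m +
        3 * Complex.I * m * posExtend (shiftConv fun n => c n t) m
  have hd : ∀ m : ℤ, ∀ t ∈ Ioo 0 T, ‖d m t‖ ≤ (ν + |α| + 3) * C * |(m : ℝ)| ^ p := by
    intro m t ht
    rcases nonpos_or_eq_succ m with h | ⟨n, rfl⟩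
    · simp only [d, posExtend_of_nonpos _ h, mul_zero, add_zero, norm_zero]
      positivity
    · simp only [d, posExtend_succ]
      have h1 := hC n t (hT ht)
      have h2 := hC' n t (hT ht)
      have h3 := norm_symbol_le hν γ α n
      have h5 : (1 : ℝ) ≤ (n : ℝ) + 1 := by linarith [n.cast_nonneg (α := ℝ)]
      have h4 : (n : ℝ) + 1 ≤ ((n : ℝ) + 1) ^ p := le_self_pow₀ h5 (by omega)
      have e : ‖((n : ℂ) + 1)‖ = (n : ℝ) + 1 := by
        rw [← Nat.cast_succ, Complex.norm_natCast]; simp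
      refine (norm_add_le _ _).trans ?_
      rw [norm_mul, norm_mul, norm_mul, norm_mul, norm_neg, Complex.norm_I]
      push_cast
      rw [e, abs_of_nonneg (by positivity : (0 : ℝ) ≤ (n : ℝ) + 1), Complex.norm_ofNat, mul_one]
      calc _ ≤ ((ν + |α|) * ((n : ℝ) + 1) ^ p) * C + 3 * ((n : ℝ) + 1) ^ p * C := by gcongr
        _ = _ := by ring
  have hpair : ∀ τ, HasSum (fun k : ℤ => 2 * π * (periodicCoeff φ k * fourierCoeff (u τ) (-k)))
      (pairing (u τ) φ) := fun τ =>
    hasSum_pairing (integrable_L2Torus _) (summable_periodicCoeff hφ) hφ.eq_tsum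
  have hsq : ∀ m, fourierCoeff (fun x => u t x ^ 2) m = posExtend (shiftConv fun n => c n t) m := by
    intro m
    have h1 := hasSum_fourierCoeff_sq (u t) m
    simp only [hu t (hT ht)] at h1
    exact h1.unique (hasSum_posExtend_convolution (fun n => c n t) m)
  have hder : HasDerivAt (fun τ => ∑' k : ℤ, 2 * π * (periodicCoeff φ k *
      posExtend (fun n => c n τ) (-k))) (∑' k : ℤ, 2 * π * (periodicCoeff φ k * d (-k) t)) t := by
    have hbd : Summable fun k : ℤ => 2 * π * ((ν + |α| + 3) * C) * (|(k : ℝ)| ^ p * ‖periodicCoeff φ k‖) :=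
      (summable_pow_mul_periodicCoeff hφ p).mul_left _
    refine hasDerivAt_tsum_of_isPreconnected
      (g := fun (k : ℤ) (τ : ℝ) => 2 * π * (periodicCoeff φ k * posExtend (fun n => c n τ) (-k)))
      (g' := fun k τ => 2 * π * (periodicCoeff φ k * d (-k) τ)) hbd isOpen_Ioo isPreconnected_Ioo
      (fun k τ _ => ?_) (fun k τ hτ => ?_) ht ?_ ht
    · exact ((hasDerivAt_posExtend_modeCoeff ν γ α a (-k) τ).const_mul _).const_mul _
    · have h1 := hd (-k) τ hτ
      rw [Int.cast_neg, abs_neg] at h1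
      have e : ‖(2 * π : ℂ)‖ = 2 * π := by
        rw [norm_mul, Complex.norm_real, Real.norm_of_nonneg Real.pi_pos.le]; simp
      rw [norm_mul (2 * π : ℂ), norm_mul (periodicCoeff φ k), e]
      have := Real.pi_pos
      calc 2 * π * (‖periodicCoeff φ k‖ * ‖d (-k) τ‖)
          ≤ 2 * π * (‖periodicCoeff φ k‖ * ((ν + |α| + 3) * C * |(k : ℝ)| ^ p)) := by gcongr
        _ = _ := by ring
    · have := (hpair t).summable
      simpa only [hu t (hT ht)] using this
  have hEq : (fun τ => pairing (u τ) φ) =ᶠ[𝓝 t] fun τ => ∑' k : ℤ, 2 * π * (periodicCoeff φ k *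
      posExtend (fun n => c n τ) (-k)) := by
    filter_upwards [Ioo_mem_nhds ht.1 ht.2] with τ hτ
    rw [← (hpair τ).tsum_eq]
    simp only [hu τ (hT hτ), hcdef]
  refine (hder.congr_of_eventuallyEq hEq).congr_deriv ?_
  have h1 := hasSum_pairing (integrable_sq_L2Torus (u t)) (summable_periodicCoeff hφ.deriv)
    hφ.deriv.eq_tsum
  have h3 := hasSum_pairing (integrable_L2Torus (u t)) (summable_periodicCoeff (hφ.iteratedDeriv 3))
    (hφ.iteratedDeriv 3).eq_tsum
  have h2 := hasSum_pairing (integrable_L2Torus (u t))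
    (c := fun k => ((|(k : ℝ)| ^ (2 * γ) : ℝ) : ℂ) * periodicCoeff φ k)
    (ψ := fracLaplacian γ φ) (by
      refine Summable.of_nonneg_of_le (fun k => norm_nonneg _) (fun k => ?_)
        (summable_pow_mul_periodicCoeff hφ ⌈2 * γ⌉₊)
      rw [norm_mul, Complex.norm_real, Real.norm_of_nonneg (by positivity)]
      gcongr
      -- At `k = 0` both powers vanish because their exponents are nonzero; elsewhere `|k| ≥ 1` and
      -- the larger exponent wins.
      rcases eq_or_ne k 0 with rfl | hk
      · have : ⌈2 * γ⌉₊ ≠ 0 := (Nat.ceil_pos.2 (by linarith)).ne'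
        simp [this, Real.zero_rpow (show 2 * γ ≠ 0 by linarith)]
      · have : (1 : ℝ) ≤ |(k : ℝ)| := by exact_mod_cast Int.one_le_abs hk
        rw [← Real.rpow_natCast]
        exact Real.rpow_le_rpow_of_exponent_le this (Nat.le_ceil _)) (fun x => rfl)
  simp only [periodicCoeff_deriv hφ, periodicCoeff_iteratedDeriv hφ, hsq, hu t (hT ht)] at h1 h2 h3
  have h4 := ((h1.mul_left (-3)).sub (h2.mul_left (ν : ℂ))).add (h3.mul_left (α : ℂ))
  rw [← h4.tsum_eq]
  congr 1
  ext k
  simp only [d, symbol, Int.cast_neg, abs_neg]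
  push_cast
  linear_combination (-2 * π * α * k ^ 3 * Complex.I * periodicCoeff φ k *
    posExtend (fun n => c n t) (-k)) * Complex.I_sq

theorem exists_isSolution {ν γ s ε R T : ℝ} (hν : 0 < ν) (hγ : 1 / 2 < γ) (hs : 1 / 2 < s)
    (hε : 0 < ε) (hT0 : 0 < T)
    (hT : ∀ k x t : ℝ, 1 ≤ k → ν / 2 * k ^ (2 * γ) ≤ x → 0 ≤ t → t ≤ T →
      3 * k * ((1 - Real.exp (-x * t)) / x) ≤ ε)
    (hsmall : 16 * ε ^ 2 * algConst s * R ^ 2 ≤ 1) (α : ℝ) {u₀ : L2Torus} (hu₀ : MemH s u₀)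
    (hpos : PositiveModes u₀) (hR : normH s u₀ = R) :
    ∃ u : ℝ → L2Torus, IsSolution ν γ α s T u₀ u ∧ ∀ t ∈ Ico 0 T, PositiveModes (u t) := by
  set a : ℕ → ℂ := fun n => fourierCoeff u₀ (n + 1) with ha
  set c : ℕ → ℝ → ℂ := modeCoeff (fun n => symbol ν γ α (n + 1)) a with hc
  set M : ℕ → ℝ := majorant ε fun n => ‖a n‖ with hM
  have hM0 : ∀ n, 0 ≤ M n := majorant_nonneg hε.le fun n => norm_nonneg _
  have hext : ∀ k, posExtend a k = fourierCoeff u₀ k := by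
    intro k
    rcases nonpos_or_eq_succ k with h | ⟨n, rfl⟩
    · rw [posExtend_of_nonpos _ h, hpos k h]
    · rw [posExtend_succ]
  have hsum : ∀ N, ∑ n ∈ Finset.range N, weight s n * ‖a n‖ ^ 2 ≤ R ^ 2 := by
    intro N
    rw [← hR, normH, Real.sq_sqrt (tsum_nonneg fun k => by positivity)]
    have h1 := hu₀.sum_le_tsum ((Finset.range N).map ⟨_, succ_int_injective⟩)
      fun k _ => by positivity
    rw [Finset.sum_map] at h1
    refine le_trans (le_of_eq (Finset.sum_congr rfl fun n _ => ?_)) h1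
    simp [weight, ha]
  have hMs : Summable fun n => weight s n * M n ^ 2 :=
    summable_weight_mul_majorant_sq hs hsum hsmall
  have hdecay := norm_modeCoeff_le hν hγ hε.le hT α a
  have hexp : ∀ n : ℕ, ∀ t ∈ Ico 0 T, Real.exp (-(ν / 2) * t * (n + 1)) ≤ 1 := by
    intro n t ht
    apply Real.exp_le_one_iff.2
    have : 0 ≤ ν / 2 * t * (n + 1) := mul_nonneg (mul_nonneg (by linarith) ht.1) (by positivity)
    linarith
  have hcM : ∀ n, ∀ t ∈ Ico 0 T, ‖c n t‖ ≤ M n := fun n t ht =>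
    (hdecay n t ht).trans (mul_le_of_le_one_left (hM0 n) (hexp n t ht))
  have hG0 := shiftConv_nonneg hM0
  -- The recursion itself bounds the convolution: `ε (M * M)ₙ = Mₙ - |aₙ|`, so no further algebra
  -- estimate is needed.
  have hGM : ∀ n, shiftConv M n ≤ M n / ε := by
    intro n
    rw [le_div_iff₀ hε]
    have := majorant_eq ε (fun n => ‖a n‖) n
    have := norm_nonneg (a n)
    simp only [hM]
    linarith
  have haM : ∀ n, ‖a n‖ ≤ M n := by
    intro n
    have h1 := majorant_eq ε (fun n => ‖a n‖) n
    have h2 := mul_nonneg hε.le (hG0 n)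
    simp only [hM] at h2 ⊢
    linarith
  -- A uniform bound from `M ≤ 1 + M²` and `wₙ ≥ 1`.
  have hMle : ∀ n, M n ≤ 1 + ∑' n, weight s n * M n ^ 2 := by
    intro n
    have h1 := hMs.le_tsum n fun n _ => mul_nonneg (weight_pos s n).le (sq_nonneg _)
    have h2 := one_le_weight (s := s) (by linarith) n
    nlinarith [sq_nonneg (M n), sq_nonneg (M n - 1)]
  set S := 1 + ∑' n, weight s n * M n ^ 2
  have hS0 : 0 ≤ S := (hM0 0).trans (hMle 0)
  have hcG : ∀ n, ∀ t ∈ Ico 0 T, ‖shiftConv (fun n => c n t) n‖ ≤ shiftConv M n := by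
    intro n t ht
    refine (norm_shiftConv_le (M := M) (q := -(ν / 2) * t) fun i _ => hdecay i t ht).trans ?_
    exact mul_le_of_le_one_left (hG0 n) (hexp n t ht)
  have hL2 : ∀ t ∈ Ico 0 T, Summable fun k => ‖posExtend (fun n => c n t) k‖ ^ 2 := by
    intro t ht
    have hbd := summable_posExtend hMs
    refine Summable.of_nonneg_of_le (fun k => by positivity) (fun k => ?_) hbd
    have h1 : (1 : ℝ) ≤ (1 + (k : ℝ) ^ 2) ^ s :=
      Real.one_le_rpow (by nlinarith [sq_nonneg (k : ℝ)]) (by linarith)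
    calc ‖posExtend (fun n => c n t) k‖ ^ 2
        ≤ (1 + (k : ℝ) ^ 2) ^ s * ‖posExtend (fun n => c n t) k‖ ^ 2 :=
          le_mul_of_one_le_left (by positivity) h1
      _ ≤ _ := by
          rw [weight_mul_norm_posExtend_sq]
          refine posExtend_mono (fun n => ?_) k
          have := weight_pos s n
          have := hcM n t ht
          gcongr
  -- Outside `[0, T)` the value is irrelevant and is taken to be `0`.
  have hex : ∀ t, ∃ f : L2Torus, t ∈ Ico 0 T → ∀ k, fourierCoeff f k = posExtend (fun n => c n t) k := by
    intro t
    by_cases ht : t ∈ Ico 0 T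
    · obtain ⟨f, hf⟩ := exists_L2Torus_fourierCoeff (hL2 t ht)
      exact ⟨f, fun _ => hf⟩
    · exact ⟨0, fun h => absurd h ht⟩
  choose u hu using hex
  have hcc : ∀ n, Continuous (c n) := fun n => continuous_modeCoeff _ _ n
  refine ⟨u, ⟨continuousIntoH_of_modes hu hcc hMs hcM, ?_, ?_, ?_⟩, fun t ht k hk => ?_⟩
  · refine sqIntegrableIntoHomH_of_modes (D := 1 / ν + 72 / ν ^ 3 / ε ^ 2) measurableSet_Ico
      (by linarith) hu hcc hMs fun n => ?_
    refine (lintegral_modeCoeff_le hν hγ hM0 hdecay n).trans (ENNReal.ofReal_le_ofReal ?_)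
    have h1 := haM n
    have h2 := hGM n
    have h3 := hG0 n
    calc 1 / ν * ‖a n‖ ^ 2 + 72 / ν ^ 3 * shiftConv M n ^ 2
        ≤ 1 / ν * M n ^ 2 + 72 / ν ^ 3 * (M n / ε) ^ 2 := by gcongr
      _ = _ := by field_simp
  · refine L2Torus_ext fun k => ?_
    rw [hu 0 ⟨le_rfl, hT0⟩ k, ← hext k]
    simp only [hc, modeCoeff_zero]
  · refine solvesEquation_of_modes (C := S + S / ε) hν.le (by linarith) hu
      (fun n t ht => ?_) (fun n t ht => ?_)
    · have : 0 ≤ S / ε := by positivity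
      linarith [hcM n t ht, hMle n]
    · have : M n / ε ≤ S / ε := by gcongr; exact hMle n
      linarith [hcG n t ht, hGM n]
  · rw [hu t ht k, posExtend_of_nonpos _ hk]

end KdVBurgers

/-! ### Choice of the existence time and conclusion. -/

theorem theorem2p5 (ν γ s : ℝ) (hν : 0 < ν) (hγ : 1 / 2 < γ) (hs : 1 / 2 < s) :
    ∃ T : ℝ → ℝ, (∀ R, 0 ≤ R → 0 < T R) ∧
      ∀ (α : ℝ) (u₀ : KdVBurgers.L2Torus), KdVBurgers.MemH s u₀ → KdVBurgers.PositiveModes u₀ →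
        ∃ u : ℝ → KdVBurgers.L2Torus,
          KdVBurgers.IsSolution ν γ α s (T (KdVBurgers.normH s u₀)) u₀ u ∧
          (∀ t ∈ Set.Ico 0 (T (KdVBurgers.normH s u₀)), KdVBurgers.PositiveModes (u t)) ∧
          ∀ v : ℝ → KdVBurgers.L2Torus,
            KdVBurgers.IsSolution ν γ α s (T (KdVBurgers.normH s u₀)) u₀ v →
            ∀ t ∈ Set.Ico 0 (T (KdVBurgers.normH s u₀)), v t = u t := by
  have hA := KdVBurgers.algConst_nonneg s
  set A := KdVBurgers.algConst s with hAdef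
  -- This makes `16ε²AR² = AR²/((A+1)(|R|+1))² ≤ 1`; adding `1` to `A` and `|R|` keeps `ε` positive
  -- and finite for every real `R`.
  let ε : ℝ → ℝ := fun R => 1 / (4 * (A + 1) * (|R| + 1))
  have hε : ∀ R, 0 < ε R := fun R => by positivity
  have hsmall : ∀ R, 16 * ε R ^ 2 * A * R ^ 2 ≤ 1 := by
    intro R
    have h1 : 16 * ε R ^ 2 * A * R ^ 2 = A * R ^ 2 / ((A + 1) * (|R| + 1)) ^ 2 := by
      simp only [ε]
      field_simp
      ring
    rw [h1, div_le_one (by positivity), mul_pow]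
    have h2 : A ≤ (A + 1) ^ 2 := by nlinarith
    have h3 : R ^ 2 ≤ (|R| + 1) ^ 2 := by
      rw [← sq_abs]
      have := abs_nonneg R
      gcongr
      linarith
    gcongr
  -- The rate constant is `ν/2` because half of the dissipation has been spent on the exponential
  -- decay.
  choose T hT0 hT using fun R => KdVBurgers.exists_time (c := ν / 2) hγ (by positivity) (hε R)
  refine ⟨T, fun R _ => hT0 R, fun α u₀ hu₀ hpos => ?_⟩
  obtain ⟨u, hu, hup⟩ := KdVBurgers.exists_isSolution hν hγ hs (hε _) (hT0 _) (hT _) (hsmall _) α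
    hu₀ hpos rfl
  exact ⟨u, hu, hup, fun v hv t ht => hu.unique hν hγ hs hv ht⟩
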